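/- Let $a_0>0$, $\ell\in\mathbb R$, $\ell\neq 1$, $m\in\mathbb C$ and $\varepsilon>0$. On the spacetime $\{(x,t): x\in\mathbb R^3,\ t>0\}$ with the metric $dt^2-a(t)^2|dx|^2$, $a(t)=a_0t^{\ell}$, consider the Cauchy problem for the Dirac equation $$\Big(i\gamma^0\partial_t+\frac{i}{a(t)}\sum_{k=1}^3\gamma^k\partial_{x_k}+i\frac{3\dot a(t)}{2a(t)}\gamma^0-\frac{m}{t}\,\mathbb I_4\Big)\Psi(x,t)=0\quad (t>\varepsilon),\qquad \Psi(x,\varepsilon)=\Phi(x),\tag{1}$$ where $\gamma^0=\mathrm{diag}(\mathbb I_2,-\mathbb I_2)$, $\gamma^k=\begin{pmatrix}0&\sigma^k\\-\sigma^k&0\end{pmatrix}$ and $\sigma^1,\sigma^2,\sigma^3$ are the Pauli matrices. Problem (1) is said to obey Huygens' principle if, for every $\Phi\in C_0^\infty(\mathbb R^3;\mathbb C^4)$, the (classical) solution $\Psi$ vanishes at every point $(x,t)$, $t>\varepsilon$, that cannot be reached by a null geodesic of the metric from a point $(y,\varepsilon)$ with $y\in\operatorname{supp}\Phi$. Put $\phi(t)=\frac{1}{1-\ell}t^{1-\ell}$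 and, for $\mu\in\mathbb C$, $t>\varepsilon$ and $0\le r\le\phi(t)-\phi(\varepsilon)$, with $M=\frac{i\mu}{1-\ell}$, $$K_1(r,t;\mu;\varepsilon)=2^{2M}\phi(\varepsilon)^{2M-1}\big((\phi(t)+\phi(\varepsilon))^2-r^2\big)^{-M}F\Big(M,M;1;\frac{(\phi(t)-\phi(\varepsilon))^2-r^2}{(\phi(t)+\phi(\varepsilon))^2-r^2}\Big),$$ where $F$ is the Gauss hypergeometric function and the powers are principal. Suppose that there are constants $a_\pm\in\mathbb C$ (depending on $m,\varepsilon$, but not on $r,t$) and functions $b_\pm$ of $t$ such that $$K_1(r,t;m;\varepsilon)=r^2a_++b_+(t),\qquad K_1(r,t;-m;\varepsilon)=r^2a_-+b_-(t)$$ for all $t>\varepsilon$ and $0\le r\le\phi(t)-\phi(\varepsilon)$. Then problem (1) obeys Huygens' principle. -/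

import Mathlib

open Complex Matrix

noncomputable section

namespace DiracFLRW

/-- Three-dimensional Euclidean space. -/
abbrev Space : Type := EuclideanSpace ℝ (Fin 3)

/-- Four-component spinors. -/
abbrev Spinor : Type := Fin 4 → ℂ

/-- The scale factor `a(t) = a₀ t ^ ℓ`. -/
def scaleFactor (a₀ ℓ t : ℝ) : ℝ := a₀ * t ^ ℓ

/-- `φ(t) = t ^ (1 - ℓ) / (1 - ℓ)`. -/
def phi (ℓ t : ℝ) : ℝ := t ^ (1 - ℓ) / (1 - ℓ)

/-! ### The spacetime and its null geodesics -/

/-- The spatially flat FLRW metric `diag (1, -a², -a², -a²)` in the coordinates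
`(x₀, x₁, x₂, x₃)`, where `x₀ = t`. -/
def metric (a₀ ℓ : ℝ) (p : Fin 4 → ℝ) : Matrix (Fin 4) (Fin 4) ℝ :=
  Matrix.diagonal
    ![1, -(scaleFactor a₀ ℓ (p 0)) ^ 2, -(scaleFactor a₀ ℓ (p 0)) ^ 2,
      -(scaleFactor a₀ ℓ (p 0)) ^ 2]

/-- The partial derivative `∂_μ f` at `p`. -/
def partialDeriv (μ : Fin 4) (f : (Fin 4 → ℝ) → ℝ) (p : Fin 4 → ℝ) : ℝ :=
  fderiv ℝ f p (Pi.single μ 1)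

/-- The Christoffel symbol
`Γ^κ_{μν} = ½ g^{κσ} (∂_μ g_{σν} + ∂_ν g_{σμ} - ∂_σ g_{μν})` of a metric `g` given in
coordinates. -/
def christoffel (g : (Fin 4 → ℝ) → Matrix (Fin 4) (Fin 4) ℝ) (p : Fin 4 → ℝ)
    (κ μ ν : Fin 4) : ℝ :=
  1 / 2 * ∑ σ : Fin 4, (g p)⁻¹ κ σ *
    (partialDeriv μ (fun q => g q σ ν) p + partialDeriv ν (fun q => g q σ μ) p
      - partialDeriv σ (fun q => g q μ ν) p)

/-- `c`, with velocity `v`, is an affinely parametrized null geodesic segment on `[0, 1]` in the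
spacetime `{x₀ > 0}` with the FLRW metric: it solves
`c''^κ + Γ^κ_{μν}(c) c'^μ c'^ν = 0`, and its velocity is null and nowhere zero. -/
structure IsNullGeodesic (a₀ ℓ : ℝ) (c v : ℝ → Fin 4 → ℝ) : Prop where
  time_pos : ∀ s ∈ Set.Icc (0 : ℝ) 1, 0 < c s 0
  velocity : ∀ s ∈ Set.Icc (0 : ℝ) 1, HasDerivWithinAt c (v s) (Set.Icc 0 1) s
  geodesic : ∀ s ∈ Set.Icc (0 : ℝ) 1,
    HasDerivWithinAt v
      (fun κ => -∑ μ : Fin 4, ∑ ν : Fin 4,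
        christoffel (metric a₀ ℓ) (c s) κ μ ν * v s μ * v s ν)
      (Set.Icc 0 1) s
  null : ∀ s ∈ Set.Icc (0 : ℝ) 1, v s ⬝ᵥ (metric a₀ ℓ (c s) *ᵥ v s) = 0
  ne_zero : ∀ s ∈ Set.Icc (0 : ℝ) 1, v s ≠ 0

/-- The spacetime point with time coordinate `t` and space coordinates `x`. -/
def event (x : Space) (t : ℝ) : Fin 4 → ℝ := ![t, x 0, x 1, x 2]

/-- The event `(x, t)` can be reached from the event `(y, s)` by a null geodesic. -/
def NullReachable (a₀ ℓ : ℝ) (y : Space) (s : ℝ) (x : Space) (t : ℝ) : Prop :=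
  ∃ c v : ℝ → Fin 4 → ℝ, IsNullGeodesic a₀ ℓ c v ∧ c 0 = event y s ∧ c 1 = event x t

/-! ### The Dirac equation -/

/-- The contravariant gamma matrices `γ⁰, γ¹, γ², γ³`. -/
def gammaMatrix : Fin 4 → Matrix (Fin 4) (Fin 4) ℂ :=
  ![!![1, 0, 0, 0; 0, 1, 0, 0; 0, 0, -1, 0; 0, 0, 0, -1],
    !![0, 0, 0, 1; 0, 0, 1, 0; 0, -1, 0, 0; -1, 0, 0, 0],
    !![0, 0, 0, -I; 0, 0, I, 0; 0, I, 0, 0; -I, 0, 0, 0],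
    !![0, 0, 1, 0; 0, 0, 0, -1; -1, 0, 0, 0; 0, 1, 0, 0]]

/-- The Dirac operator
`i γ⁰ ∂_t + (i / a) ∑ₖ γᵏ ∂_{xₖ} + i (3 a' / (2 a)) γ⁰ - m t⁻¹`
applied to the spinor field `Ψ`, at the point `(x, t)`. -/
def diracOp (a₀ ℓ : ℝ) (m : ℂ) (Ψ : Space → ℝ → Spinor) (x : Space) (t : ℝ) : Spinor :=
  I • (gammaMatrix 0 *ᵥ deriv (fun s => Ψ x s) t)
    + ∑ k : Fin 3, (I / (scaleFactor a₀ ℓ t : ℂ)) •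
        (gammaMatrix k.succ *ᵥ fderiv ℝ (fun y => Ψ y t) x (EuclideanSpace.single k 1))
    + (I * (3 * ((deriv (scaleFactor a₀ ℓ) t : ℝ) : ℂ) / (2 * (scaleFactor a₀ ℓ t : ℂ)))) •
        (gammaMatrix 0 *ᵥ Ψ x t)
    - (m / (t : ℂ)) • Ψ x t

/-- `Ψ` is a classical solution of the Cauchy problem for the Dirac equation with initial datum
`Φ` at the time `ε`. Only the values of `Ψ` at times `t ≥ ε` matter. -/
structure IsSolution (a₀ ℓ : ℝ) (m : ℂ) (ε : ℝ) (Φ : Space → Spinor)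
    (Ψ : Space → ℝ → Spinor) : Prop where
  continuousOn : ContinuousOn (fun p : Space × ℝ => Ψ p.1 p.2) {p | ε ≤ p.2}
  contDiffOn : ContDiffOn ℝ 1 (fun p : Space × ℝ => Ψ p.1 p.2) {p | ε < p.2}
  equation : ∀ x t, ε < t → diracOp a₀ ℓ m Ψ x t = 0
  initial : ∀ x, Ψ x ε = Φ x

/-- Huygens' principle for the Dirac equation with initial time `ε`: the solution vanishes at all
points that cannot be reached by a null geodesic from the support of the initial datum. -/
def ObeysHuygens (a₀ ℓ : ℝ) (m : ℂ) (ε : ℝ) : Prop :=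
  ∀ (Φ : Space → Spinor), ContDiff ℝ (⊤ : ℕ∞) Φ → HasCompactSupport Φ →
    ∀ (Ψ : Space → ℝ → Spinor), IsSolution a₀ ℓ m ε Φ Ψ →
      ∀ (x : Space) (t : ℝ), ε < t →
        (∀ y ∈ tsupport Φ, ¬ NullReachable a₀ ℓ y ε x t) → Ψ x t = 0

/-! ### The kernel of the representation formula -/

/-- The kernel `K₁(r, t; m; ε)`, with `M = i m / (1 - ℓ)`:
`2^(2M) φ(ε)^(2M-1) ((φ(t)+φ(ε))² - r²)^(-M)
  F(M, M; 1; ((φ(t)-φ(ε))² - r²) / ((φ(t)+φ(ε))² - r²))`. -/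
def K₁ (ℓ : ℝ) (m : ℂ) (ε r t : ℝ) : ℂ :=
  (2 : ℂ) ^ (2 * (I * (m / (1 - ℓ)))) *
    (phi ℓ ε : ℂ) ^ (2 * (I * (m / (1 - ℓ))) - 1) *
    (((phi ℓ t + phi ℓ ε) ^ 2 - r ^ 2 : ℝ) : ℂ) ^ (-(I * (m / (1 - ℓ)))) *
    ordinaryHypergeometric (I * (m / (1 - ℓ))) (I * (m / (1 - ℓ))) (1 : ℂ)
      (((((phi ℓ t - phi ℓ ε) ^ 2 - r ^ 2) / ((phi ℓ t + phi ℓ ε) ^ 2 - r ^ 2) : ℝ)) : ℂ)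

end DiracFLRW

end

noncomputable section

namespace DiracFLRW

/-! ### Parameters for which the kernel is an affine function of `r ^ 2` -/

/-! The kernels `K₁` are used only to find the admissible masses. Put `M = i m / (1 - ℓ)`. With `z`
the hypergeometric argument, `(φ(t) + φ(ε))² - r²` is a constant times `1 / (1 - z)`. A kernel
affine in `r²` therefore makes `F(M, M; 1; z)` a combination of `(1 - z)^(-M)` and `(1 - z)^(-M-1)`,
and three Taylor coefficients force `M ∈ {0, -1, 1, 2}` (`hypergeometric_eq_combination`,
`K₁_affine_parameter`). The same holds for `-M`, which leaves `M ∈ {0, 1, -1}`.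

For these `M`, Huygens' principle is proved by duality, for an arbitrary classical solution and
without a representation formula. In the conformal time `τ = φ / a₀` the mass term becomes `M / τ`,
and the squared Dirac operator acts on the two halves of a spinor as a wave operator with potential
proportional to `M (M - 1) / τ²` and `M (M + 1) / τ²` respectively. At least one potential vanishes,
so spherical waves `b(τ + r) / r` give explicit solutions of the adjoint equation built only from
`b` and `b'`, hence supported where `τ + r` lies in the support of `b` (`exists_radialKernel`).

These adjoint solutions are singular on the axis `y = 0`. Cut off near the axis and paired with a
solution `ψ`, they satisfy a conservation law whose defect lives where `‖y‖` is of order `δ`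
(`conservation_law`). As `δ → 0` the defect becomes a nonzero multiple of an integral over `t` of
`P(0, t)` times a lower component of `ψ` at `y = 0` (`integral_kernel_vertex_eq_zero`). If the data
vanish near the sphere where the backward cone from `(0, t₀)` meets time `ε`, there is no boundary
term, and letting `b` be a bump at `τ(t₀)` kills the lower components at `(0, t₀)`. Exchanging the
two halves of the spinor replaces `m` by `-m` and gives the upper ones. Finally, every point of that
sphere is joined to the vertex by a null geodesic (`nullReachable_of_dist`), so unreachability says
exactly what is needed about the support. -/

theorem ringChoose_two (a : ℂ) : Ring.choose a 2 = a * (a - 1) / 2 := by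
  have h := Ring.descPochhammer_eq_factorial_smul_choose a 2
  simp [descPochhammer_succ_right, Polynomial.smeval_mul, Nat.factorial] at h
  rw [h]; ring

/-- The radius of convergence is infinite when `M` is a nonpositive integer (the series is a
polynomial) and `1` otherwise. -/
theorem hasFPowerSeriesAt_hypergeometric (M : ℂ) :
    HasFPowerSeriesAt (ordinaryHypergeometric M M (1 : ℂ) : ℂ → ℂ)
      (ordinaryHypergeometricSeries ℂ M M (1 : ℂ)) 0 := by
  have hr : 0 < (ordinaryHypergeometricSeries ℂ M M (1 : ℂ)).radius := by
    by_cases h : ∃ k : ℕ, (k : ℂ) = -M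
    · obtain ⟨k, hk⟩ := h
      have : M = -(k : ℂ) := by rw [hk]; ring
      rw [this, ordinaryHypergeometric_radius_top_of_neg_nat₁]
      exact ENNReal.zero_lt_top
    · push Not at h
      rw [ordinaryHypergeometricSeries_radius_eq_one]
      · exact zero_lt_one
      · intro k
        refine ⟨h k, h k, fun hk => ?_⟩
        have := congrArg Complex.re hk
        simp at this
        have h0 : (0 : ℝ) ≤ k := k.cast_nonneg
        linarith
  exact (FormalMultilinearSeries.hasFPowerSeriesOnBall _ hr).hasFPowerSeriesAt

/-- If `₂F₁(M, M; 1; z)` is a combination of `(1 - z) ^ (-M)` and `(1 - z) ^ (-M - 1)` on a real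
interval `(0, z₁)`, then `M ∈ {0, -1, 1, 2}`. -/
theorem hypergeometric_eq_combination {M A B : ℂ} {z₁ : ℝ} (hz₁ : 0 < z₁)
    (h : ∀ z : ℝ, 0 < z → z < z₁ → ordinaryHypergeometric M M (1 : ℂ) (z : ℂ) =
      A * (1 / (1 - (z : ℂ)) ^ M) + B * (1 / (1 - (z : ℂ)) ^ (M + 1))) :
    M * (M + 1) * (M - 1) * (M - 2) = 0 := by
  have hF := hasFPowerSeriesAt_hypergeometric M
  have hG := ((one_div_one_sub_cpow_hasFPowerSeriesOnBall_zero M).hasFPowerSeriesAt.const_smul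
    (c := A)).add ((one_div_one_sub_cpow_hasFPowerSeriesOnBall_zero
      (M + 1)).hasFPowerSeriesAt.const_smul (c := B))
  -- The identity is known only on a real interval with endpoint `0`; since `0` is an accumulation
  -- point, the identity theorem extends it to a complex neighbourhood.
  have hfreq : ∃ᶠ z in nhdsWithin (0 : ℂ) {0}ᶜ, ordinaryHypergeometric M M (1 : ℂ) z =
      (A • (fun x : ℂ => 1 / (1 - x) ^ M) + B • fun x : ℂ => 1 / (1 - x) ^ (M + 1)) z := by
    have ht : Filter.Tendsto (fun x : ℝ => (x : ℂ)) (nhdsWithin 0 (Set.Ioi 0))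
        (nhdsWithin (0 : ℂ) {0}ᶜ) := by
      refine tendsto_nhdsWithin_of_tendsto_nhds_of_eventually_within _ ?_ ?_
      · exact (Complex.continuous_ofReal.tendsto' 0 0 (by simp)).mono_left nhdsWithin_le_nhds
      · filter_upwards [self_mem_nhdsWithin] with x hx
        simpa using (ne_of_gt hx)
    refine ht.frequently (Filter.Eventually.frequently ?_)
    filter_upwards [Ioo_mem_nhdsGT hz₁] with x hx
    rw [h x hx.1 hx.2]; rfl
  have hev := (hF.analyticAt.frequently_eq_iff_eventually_eq hG.analyticAt).1 hfreq
  have hser := hF.eq_formalMultilinearSeries_of_eventually hG hev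
  have hc (n : ℕ) : ordinaryHypergeometricCoefficient M M (1 : ℂ) n =
      A * Ring.choose (M + n - 1) n + B * Ring.choose (M + 1 + n - 1) n := by
    have := congrArg (fun p : FormalMultilinearSeries ℂ ℂ ℂ => p n (fun _ => (1 : ℂ))) hser
    simpa [ordinaryHypergeometricSeries, FormalMultilinearSeries.ofScalars_apply_eq] using this
  have h0 := hc 0
  have h1 := hc 1
  have h2 := hc 2
  simp only [ordinaryHypergeometricCoefficient, ringChoose_two] at h0 h1 h2
  simp [ascPochhammer_succ_right, Nat.factorial] at h0 h1 h2
  ring_nf at h0 h1 h2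
  -- The weights `4`, `-4 (M + 1)`, `2 M (M + 1)` annihilate the first three coefficients of both
  -- binomial series, which eliminates `A` and `B`.
  linear_combination 4 * h2 + (-4 * M - 4) * h1 + (2 * M ^ 2 + 2 * M) * h0

theorem phi_hasDerivAt {ℓ : ℝ} (hℓ : ℓ ≠ 1) {t : ℝ} (ht : 0 < t) :
    HasDerivAt (phi ℓ) (t ^ (-ℓ)) t := by
  have h := (Real.hasDerivAt_rpow_const (x := t) (p := 1 - ℓ) (Or.inl ht.ne')).div_const (1 - ℓ)
  have h1 : (1 - ℓ) ≠ 0 := sub_ne_zero.2 hℓ.symm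
  rw [mul_div_cancel_left₀ _ h1, show 1 - ℓ - 1 = -ℓ by ring] at h
  exact h

theorem phi_strictMonoOn {ℓ : ℝ} (hℓ : ℓ ≠ 1) : StrictMonoOn (phi ℓ) (Set.Ioi 0) := by
  refine strictMonoOn_of_deriv_pos (convex_Ioi 0) ?_ ?_
  · exact fun t ht => (phi_hasDerivAt hℓ ht).continuousAt.continuousWithinAt
  · intro t ht
    rw [interior_Ioi] at ht
    rw [(phi_hasDerivAt hℓ ht).deriv]
    exact Real.rpow_pos_of_pos ht _

theorem phi_ne_zero {ℓ : ℝ} (hℓ : ℓ ≠ 1) {t : ℝ} (ht : 0 < t) : phi ℓ t ≠ 0 :=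
  div_ne_zero (Real.rpow_pos_of_pos ht _).ne' (sub_ne_zero.2 hℓ.symm)

theorem phi_mul_phi_pos {ℓ : ℝ} (hℓ : ℓ ≠ 1) {s t : ℝ} (hs : 0 < s) (ht : 0 < t) :
    0 < phi ℓ s * phi ℓ t := by
  have h1 : (1 - ℓ) ≠ 0 := sub_ne_zero.2 hℓ.symm
  have := Real.rpow_pos_of_pos hs (1 - ℓ)
  have := Real.rpow_pos_of_pos ht (1 - ℓ)
  rw [phi, phi, div_mul_div_comm]
  exact div_pos (by positivity) (mul_self_pos.2 h1)

/-- One time `t` suffices: as `r` decreases from `φ(t) - φ(ε)` to `0`, the hypergeometric argument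
runs through a whole interval starting at `0`. -/
theorem K₁_affine_parameter {ℓ : ℝ} (hℓ : ℓ ≠ 1) {m : ℂ} {ε t : ℝ} (hε : 0 < ε) (ht : ε < t)
    {a b : ℂ} (h : ∀ r ∈ Set.Icc (0 : ℝ) (phi ℓ t - phi ℓ ε),
      K₁ ℓ m ε r t = (r : ℂ) ^ 2 * a + b) {M : ℂ} (hM : M = I * (m / (1 - ℓ))) :
    M * (M + 1) * (M - 1) * (M - 2) = 0 := by
  have ht0 : 0 < t := hε.trans ht
  have hlt : phi ℓ ε < phi ℓ t := phi_strictMonoOn hℓ hε ht0 ht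
  set p := phi ℓ t
  set q := phi ℓ ε
  -- For `ℓ > 1` both `p` and `q` are negative, but their product is positive in every case.
  have hD : 0 < 4 * (p * q) := by have := phi_mul_phi_pos hℓ ht0 hε; positivity
  set D := 4 * (p * q)
  have hA : (p + q) ^ 2 = (p - q) ^ 2 + D := by simp only [D]; ring
  have hpq : 0 < (p - q) ^ 2 := pow_pos (sub_pos.2 hlt) 2
  have hq : (q : ℂ) ≠ 0 := by exact_mod_cast phi_ne_zero hℓ hε
  set C : ℂ := (2 : ℂ) ^ (2 * M) * (q : ℂ) ^ (2 * M - 1) with hCdef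
  have hC : C ≠ 0 := mul_ne_zero (by simp [cpow_eq_zero_iff]) (by simp [cpow_eq_zero_iff, hq])
  have hA0 : 0 < (p + q) ^ 2 := by rw [hA]; positivity
  have hDc : (D : ℂ) ^ M ≠ 0 := by
    have : (D : ℂ) ≠ 0 := by exact_mod_cast hD.ne'
    simp [cpow_eq_zero_iff, this]
  refine hypergeometric_eq_combination (z₁ := (p - q) ^ 2 / (p + q) ^ 2) (by positivity)
    -- With `s = (p + q)² - r² = D / (1 - z)`, the hypothesis reads `C s^(-M) F = ((p + q)² - s) a +
    -- b`; solving for `F` gives these `A` and `B`.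
    (A := C⁻¹ * (D : ℂ) ^ M * (((p + q) ^ 2 : ℝ) * a + b)) (B := - C⁻¹ * (D : ℂ) ^ M * a * D)
    fun z hz0 hz1 => ?_
  have hz1' : z * (p + q) ^ 2 < (p - q) ^ 2 := (lt_div_iff₀ hA0).1 hz1
  have h1z : 0 < 1 - z := by
    have : z < 1 := hz1.trans ((div_lt_one hA0).2 (by linarith))
    linarith
  set s := D / (1 - z) with hs
  have hspos : 0 < s := by positivity
  have hsD : s * (1 - z) = D := by rw [hs]; field_simp
  have hsle : s ≤ (p + q) ^ 2 := by
    rw [hs, div_le_iff₀ h1z]; linarith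
  have hDs : D ≤ s := by nlinarith
  set r := Real.sqrt ((p + q) ^ 2 - s)
  have hr2 : r ^ 2 = (p + q) ^ 2 - s := Real.sq_sqrt (by linarith)
  have hr : r ∈ Set.Icc (0 : ℝ) (p - q) := by
    refine ⟨Real.sqrt_nonneg _, ?_⟩
    apply le_of_sq_le_sq _ (by linarith)
    linarith
  have hK := h r hr
  have e1 : (p + q) ^ 2 - r ^ 2 = s := by rw [hr2]; ring
  have e2 : ((p - q) ^ 2 - r ^ 2) / s = z := by
    rw [div_eq_iff hspos.ne']; linarith
  have hr2c : (r : ℂ) ^ 2 = ((p + q) ^ 2 : ℝ) - (s : ℂ) := by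
    rw [← Complex.ofReal_pow, hr2]; push_cast; ring
  unfold K₁ at hK
  rw [← hM] at hK
  change C * _ * _ = _ at hK
  rw [e1, e2, hr2c] at hK
  have h1c : (1 : ℂ) - z = ((1 - z : ℝ) : ℂ) := by push_cast; ring
  have hsc : (s : ℂ) ^ (-M) = ((D : ℂ) ^ M)⁻¹ * ((1 : ℂ) - z) ^ M := by
    rw [hs, cpow_neg, div_eq_mul_inv, Complex.ofReal_mul,
      Complex.mul_cpow_ofReal_nonneg hD.le (by positivity), mul_inv, h1c]
    congr 1
    rw [Complex.ofReal_inv, Complex.inv_cpow, inv_inv]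
    rw [Complex.arg_ofReal_of_nonneg h1z.le]; exact Real.pi_pos.ne
  have h1c0 : (1 : ℂ) - z ≠ 0 := by rw [h1c]; exact_mod_cast h1z.ne'
  have hpow : ((1 : ℂ) - z) ^ M ≠ 0 := by simp [cpow_eq_zero_iff, h1c0]
  rw [hsc] at hK
  rw [cpow_add _ _ h1c0, cpow_one]
  have hsc' : (s : ℂ) * (1 - z) = D := by rw [h1c]; exact_mod_cast hsD
  have hF : ordinaryHypergeometric M M (1 : ℂ) (z : ℂ) =
      C⁻¹ * (D : ℂ) ^ M * (((1 : ℂ) - z) ^ M)⁻¹ * (((((p + q) ^ 2 : ℝ) : ℂ) - s) * a + b) := by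
    rw [← hK]
    field_simp
  rw [hF, ← hsc']
  field_simp
  ring

/-- The mass parameters for which both kernels are affine in `r ^ 2`. -/
theorem parameter_cases {ℓ : ℝ} (hℓ : ℓ ≠ 1) {m : ℂ} {ε : ℝ} (hε : 0 < ε)
    {aPlus aMinus : ℂ} {bPlus bMinus : ℝ → ℂ}
    (hPlus : ∀ t, ε < t → ∀ r ∈ Set.Icc (0 : ℝ) (phi ℓ t - phi ℓ ε),
      K₁ ℓ m ε r t = (r : ℂ) ^ 2 * aPlus + bPlus t)
    (hMinus : ∀ t, ε < t → ∀ r ∈ Set.Icc (0 : ℝ) (phi ℓ t - phi ℓ ε),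
      K₁ ℓ (-m) ε r t = (r : ℂ) ^ 2 * aMinus + bMinus t) :
    ∃ M : ℂ, I * m = M * (1 - ℓ) ∧ (M = 0 ∨ M = 1 ∨ M = -1) := by
  -- Any time after `ε` would do.
  have h2 : ε < 2 * ε := by linarith
  have hl : (1 - ℓ : ℂ) ≠ 0 := sub_ne_zero.2 (by exact_mod_cast hℓ.symm)
  refine ⟨I * (m / (1 - ℓ)), by field_simp, ?_⟩
  have e1 := K₁_affine_parameter hℓ hε h2 (hPlus _ h2) rfl
  have e2 := K₁_affine_parameter hℓ hε h2 (hMinus _ h2)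
    (M := -(I * (m / (1 - ℓ)))) (by ring)
  generalize I * (m / (1 - ℓ)) = M at e1 e2
  rcases mul_eq_zero.1 e1 with h | h
  · rcases mul_eq_zero.1 h with h | h
    · rcases mul_eq_zero.1 h with h | h
      · exact Or.inl h
      · exact Or.inr (Or.inr (by linear_combination h))
    · exact Or.inr (Or.inl (by linear_combination h))
  -- For `M = 2` the kernel with mass `-m` has parameter `-2`, which is not a root.
  · exfalso
    have : M = 2 := by linear_combination h
    rw [this] at e2
    norm_num at e2

/-! ### Null geodesics -/

/-- The time component of an affinely parametrized null geodesic from time `ε` to time `t`. -/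
theorem exists_affine_time (ℓ : ℝ) {ε t : ℝ} (hε : 0 < ε) (ht : ε < t) :
    ∃ (θ : ℝ → ℝ) (k : ℝ), 0 < k ∧ θ 0 = ε ∧ θ 1 = t ∧
      ∀ s ∈ Set.Icc (0 : ℝ) 1, 0 < θ s ∧ HasDerivAt θ (k * θ s ^ (-ℓ)) s := by
  have ht0 : 0 < t := hε.trans ht
  -- The equation `θ' = k θ^(-ℓ)` makes `θ^(ℓ + 1)` affine in the parameter; for `ℓ = -1` it is `log
  -- θ` that is affine.
  by_cases hl : ℓ = -1
  · refine ⟨fun s => ε * (t / ε) ^ s, Real.log (t / ε), Real.log_pos ((one_lt_div hε).2 ht),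
      by simp, by simp; field_simp, fun s _ => ⟨by positivity, ?_⟩⟩
    have hq : 0 < t / ε := by positivity
    have h := ((hasDerivAt_id s).const_rpow hq).const_mul ε
    simp only [id, mul_one] at h
    rw [hl, neg_neg, Real.rpow_one]
    convert! h using 1
    ring
  · have hl1 : ℓ + 1 ≠ 0 := fun h => hl (by linarith)
    set u := ε ^ (ℓ + 1)
    set w := t ^ (ℓ + 1)
    have hu : 0 < u := Real.rpow_pos_of_pos hε _
    have hw : 0 < w := Real.rpow_pos_of_pos ht0 _
    have hpos : ∀ s ∈ Set.Icc (0 : ℝ) 1, 0 < u + s * (w - u) := by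
      intro s hs
      have : u + s * (w - u) = (1 - s) * u + s * w := by ring
      rw [this]
      rcases hs.1.eq_or_lt with h0 | h0
      · subst h0; simpa using hu
      · have := mul_nonneg (sub_nonneg.2 hs.2) hu.le
        have := mul_pos h0 hw
        linarith
    refine ⟨fun s => (u + s * (w - u)) ^ (1 / (ℓ + 1)), (w - u) / (ℓ + 1), ?_, ?_, ?_, ?_⟩
    · rcases lt_or_gt_of_ne hl1 with h | h
      · refine div_pos_of_neg_of_neg (sub_neg.2 ?_) h
        exact Real.rpow_lt_rpow_of_neg hε ht h
      · exact div_pos (sub_pos.2 (Real.rpow_lt_rpow hε.le ht h)) h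
    · simp only [zero_mul, add_zero, u]
      rw [← Real.rpow_mul hε.le, mul_one_div_cancel hl1, Real.rpow_one]
    · simp only [one_mul, add_sub_cancel, w]
      rw [← Real.rpow_mul ht0.le, mul_one_div_cancel hl1, Real.rpow_one]
    · intro s hs
      have hp := hpos s hs
      refine ⟨Real.rpow_pos_of_pos hp _, ?_⟩
      have h1 : HasDerivAt (fun s : ℝ => u + s * (w - u)) (w - u) s := by
        simpa using ((hasDerivAt_id s).mul_const (w - u)).const_add u
      have h := h1.rpow_const (p := 1 / (ℓ + 1)) (Or.inl hp.ne')
      convert! h using 1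
      rw [← Real.rpow_mul hp.le,
        show 1 / (ℓ + 1) * -ℓ = 1 / (ℓ + 1) - 1 by field_simp; ring]
      ring

theorem scaleFactor_hasDerivAt (a₀ ℓ : ℝ) {t : ℝ} (ht : 0 < t) :
    HasDerivAt (scaleFactor a₀ ℓ) (ℓ / t * scaleFactor a₀ ℓ t) t := by
  have h := (Real.hasDerivAt_rpow_const (x := t) (p := ℓ) (Or.inl ht.ne')).const_mul a₀
  rw [Real.rpow_sub ht, Real.rpow_one,
    show a₀ * (ℓ * (t ^ ℓ / t)) = ℓ / t * (a₀ * t ^ ℓ) by ring] at h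
  exact h

theorem scaleFactor_pos {a₀ : ℝ} (ha₀ : 0 < a₀) (ℓ : ℝ) {t : ℝ} (ht : 0 < t) :
    0 < scaleFactor a₀ ℓ t := mul_pos ha₀ (Real.rpow_pos_of_pos ht _)

theorem partialDeriv_comp_time {f : ℝ → ℝ} {f' : ℝ} {p : Fin 4 → ℝ} (hf : HasDerivAt f f' (p 0))
    (μ : Fin 4) : partialDeriv μ (fun q => f (q 0)) p = if μ = 0 then f' else 0 := by
  have h : HasFDerivAt (fun q : Fin 4 → ℝ => f (q 0)) _ p :=
    hf.comp_hasFDerivAt p (ContinuousLinearMap.proj (R := ℝ) (φ := fun _ : Fin 4 => ℝ) 0).hasFDerivAt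
  rw [partialDeriv, h.fderiv]
  rcases eq_or_ne μ 0 with rfl | hμ
  · simp
  · simp [hμ]

/-- The derivative of the metric coefficients. -/
theorem partialDeriv_metric (a₀ ℓ : ℝ) {p : Fin 4 → ℝ} (hp : 0 < p 0) (μ i j : Fin 4) :
    partialDeriv μ (fun q => metric a₀ ℓ q i j) p =
      if μ = 0 ∧ i = j ∧ i ≠ 0 then -(2 * (ℓ / p 0) * scaleFactor a₀ ℓ (p 0) ^ 2) else 0 := by
  have hd : HasDerivAt (fun t => -(scaleFactor a₀ ℓ t) ^ 2)
      (-(2 * (ℓ / p 0) * scaleFactor a₀ ℓ (p 0) ^ 2)) (p 0) := by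
    convert! ((scaleFactor_hasDerivAt a₀ ℓ hp).fun_pow 2).fun_neg using 1
    push_cast; ring
  by_cases hij : i = j
  · subst hij
    by_cases hi : i = 0
    · subst hi
      have : (fun q => metric a₀ ℓ q 0 0) = fun _ => 1 := by ext q; simp [metric]
      simp [this, partialDeriv]
    · have : (fun q => metric a₀ ℓ q i i) = fun q => -(scaleFactor a₀ ℓ (q 0)) ^ 2 := by
        ext q
        fin_cases i <;> simp [metric] at hi ⊢
      rw [this, partialDeriv_comp_time hd]
      simp [hi]
  · have : (fun q => metric a₀ ℓ q i j) = fun _ => 0 := by ext q; simp [metric, hij]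
    simp [this, partialDeriv, hij]

theorem metric_inv (a₀ ℓ : ℝ) (ha₀ : 0 < a₀) {p : Fin 4 → ℝ} (hp : 0 < p 0) :
    (metric a₀ ℓ p)⁻¹ = Matrix.diagonal
      ![1, -((scaleFactor a₀ ℓ (p 0)) ^ 2)⁻¹, -((scaleFactor a₀ ℓ (p 0)) ^ 2)⁻¹,
        -((scaleFactor a₀ ℓ (p 0)) ^ 2)⁻¹] := by
  have h := (scaleFactor_pos ha₀ ℓ hp).ne'
  refine Matrix.inv_eq_right_inv ?_
  rw [metric, Matrix.diagonal_mul_diagonal, ← Matrix.diagonal_one]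
  congr 1
  ext i
  fin_cases i <;> simp [h]

theorem christoffel_metric (a₀ ℓ : ℝ) (ha₀ : 0 < a₀) {p : Fin 4 → ℝ} (hp : 0 < p 0)
    (κ μ ν : Fin 4) :
    christoffel (metric a₀ ℓ) p κ μ ν =
      if κ = 0 then (if μ = ν ∧ μ ≠ 0 then ℓ / p 0 * scaleFactor a₀ ℓ (p 0) ^ 2 else 0)
      else (if μ = 0 ∧ κ = ν then ℓ / p 0 else 0) + (if ν = 0 ∧ κ = μ then ℓ / p 0 else 0) := by
  have h := (scaleFactor_pos ha₀ ℓ hp).ne'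
  rw [christoffel, metric_inv a₀ ℓ ha₀ hp]
  simp only [partialDeriv_metric a₀ ℓ hp]
  rw [Finset.sum_eq_single κ (fun σ _ hσ => by simp [Matrix.diagonal_apply_ne _ hσ.symm])
    (by simp), Matrix.diagonal_apply_eq]
  fin_cases κ <;> fin_cases μ <;> fin_cases ν <;> simp <;> field_simp

/-- The curve follows the straight segment from `y` to `x`, with the distance travelled equal to the
elapsed conformal time; the time component from `exists_affine_time` makes the parameter affine. -/
theorem nullReachable_of_dist {a₀ ℓ : ℝ} (ha₀ : 0 < a₀) (hℓ : ℓ ≠ 1) {ε t : ℝ} (hε : 0 < ε)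
    (ht : ε < t) {x y : Space} (hxy : ‖x - y‖ = (phi ℓ t - phi ℓ ε) / a₀) :
    NullReachable a₀ ℓ y ε x t := by
  obtain ⟨θ, k, hk, h0, h1, hθ⟩ := exists_affine_time ℓ hε ht
  have ht0 : 0 < t := hε.trans ht
  have hlt : phi ℓ ε < phi ℓ t := phi_strictMonoOn hℓ hε ht0 ht
  set R := ‖x - y‖ with hR
  have hRpos : 0 < R := by rw [hxy]; exact div_pos (sub_pos.2 hlt) ha₀
  set n : Fin 3 → ℝ := fun i => (x i - y i) / R with hn
  have hn1 : n 0 ^ 2 + n 1 ^ 2 + n 2 ^ 2 = 1 := by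
    have : R ^ 2 = (x 0 - y 0) ^ 2 + (x 1 - y 1) ^ 2 + (x 2 - y 2) ^ 2 := by
      rw [hR, EuclideanSpace.real_norm_sq_eq]
      simp [Fin.sum_univ_three]
    simp only [hn, div_pow]
    rw [← add_div, ← add_div, ← this, div_self (by positivity)]
  set pos : ℝ → Fin 3 → ℝ := fun s i => y i + n i * ((phi ℓ (θ s) - phi ℓ ε) / a₀) with hpos
  set v0 : ℝ → ℝ := fun s => k * θ s ^ (-ℓ) with hv0
  set w : ℝ → ℝ := fun s => v0 s * θ s ^ (-ℓ) / a₀ with hw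
  have hsp : ∀ s ∈ Set.Icc (0 : ℝ) 1, ∀ i, HasDerivAt (fun s => pos s i) (n i * w s) s := by
    intro s hs i
    obtain ⟨hp, hd⟩ := hθ s hs
    have := (((((phi_hasDerivAt hℓ hp).comp s hd).sub_const (phi ℓ ε)).div_const a₀).const_mul
      (n i)).const_add (y i)
    convert! this using 1
    simp only [hw, hv0]; ring
  have hdv : ∀ s ∈ Set.Icc (0 : ℝ) 1, HasDerivAt v0 (-(ℓ / θ s * v0 s ^ 2)) s := by
    intro s hs
    obtain ⟨hp, hd⟩ := hθ s hs
    have := (hd.rpow_const (p := -ℓ) (Or.inl hp.ne')).const_mul k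
    convert! this using 1
    rw [Real.rpow_sub_one hp.ne']
    simp only [hv0]; ring
  have hdw : ∀ s ∈ Set.Icc (0 : ℝ) 1, HasDerivAt w (-(2 * (ℓ / θ s * v0 s * w s))) s := by
    intro s hs
    obtain ⟨hp, hd⟩ := hθ s hs
    have := ((hdv s hs).mul (hd.rpow_const (p := -ℓ) (Or.inl hp.ne'))).div_const a₀
    convert! this using 1
    rw [Real.rpow_sub_one hp.ne']
    simp only [hw, hv0]; ring
  have hsw : ∀ s ∈ Set.Icc (0 : ℝ) 1, scaleFactor a₀ ℓ (θ s) * w s = v0 s := by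
    intro s hs
    obtain ⟨hp, -⟩ := hθ s hs
    have : θ s ^ ℓ * θ s ^ (-ℓ) = 1 := by rw [← Real.rpow_add hp]; simp
    simp only [scaleFactor, hw]
    field_simp
    linear_combination v0 s * this
  refine ⟨fun s => ![θ s, pos s 0, pos s 1, pos s 2],
    fun s => ![v0 s, n 0 * w s, n 1 * w s, n 2 * w s], ⟨?_, ?_, ?_, ?_, ?_⟩, ?_, ?_⟩
  · intro s hs; exact (hθ s hs).1
  · intro s hs
    refine HasDerivAt.hasDerivWithinAt (hasDerivAt_pi.2 fun i => ?_)
    fin_cases i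
    · exact (hθ s hs).2
    · exact hsp s hs 0
    · exact hsp s hs 1
    · exact hsp s hs 2
  · intro s hs
    refine HasDerivAt.hasDerivWithinAt (hasDerivAt_pi.2 fun i => ?_)
    have hp : 0 < (![θ s, pos s 0, pos s 1, pos s 2] : Fin 4 → ℝ) 0 := (hθ s hs).1
    simp only [christoffel_metric a₀ ℓ ha₀ hp]
    have hsw' := hsw s hs
    fin_cases i
    · convert! hdv s hs using 1
      simp [Fin.sum_univ_four]
      linear_combination (-(ℓ / θ s) * scaleFactor a₀ ℓ (θ s) ^ 2 * w s ^ 2) * hn1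
        - (ℓ / θ s) * (scaleFactor a₀ ℓ (θ s) * w s + v0 s) * hsw'
    · convert! (hdw s hs).const_mul (n 0) using 1
      simp [Fin.sum_univ_four]; ring
    · convert! (hdw s hs).const_mul (n 1) using 1
      simp [Fin.sum_univ_four]; ring
    · convert! (hdw s hs).const_mul (n 2) using 1
      simp [Fin.sum_univ_four]; ring
  · intro s hs
    have hsw' := hsw s hs
    simp [metric, Matrix.mulVec_diagonal, dotProduct, Fin.sum_univ_four]
    linear_combination (- scaleFactor a₀ ℓ (θ s) ^ 2 * w s ^ 2) * hn1
        - (scaleFactor a₀ ℓ (θ s) * w s + v0 s) * hsw'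
  · intro s hs h
    have := congrFun h 0
    simp only [Matrix.cons_val_zero, Pi.zero_apply] at this
    exact (mul_pos hk (Real.rpow_pos_of_pos (hθ s hs).1 _)).ne' this
  · simp [event, hpos, h0]
  · have : ∀ i, n i * ((phi ℓ t - phi ℓ ε) / a₀) = x i - y i := by
      intro i; rw [← hxy]; simp only [hn]; field_simp
    simp [event, hpos, h1, this]

/-! ### A divergence identity -/

open MeasureTheory in
-- Integration by parts against the constant function `1`.
theorem integral_fderiv_apply_eq_zero {g : Space → ℂ} (hg : ContDiff ℝ 1 g)
    (hs : HasCompactSupport g) (v : Space) : ∫ y, fderiv ℝ g y v = 0 := by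
  have hc : Continuous fun y => fderiv ℝ g y v :=
    (hg.continuous_fderiv one_ne_zero).clm_apply continuous_const
  have hcs : HasCompactSupport fun y => fderiv ℝ g y v := hs.fderiv_apply ℝ v
  have h := integral_mul_fderiv_eq_neg_fderiv_mul_of_integrable (μ := (volume : Measure Space))
    (f := fun _ : Space => (1 : ℂ)) (g := g) (v := v) (by simp)
    (by simpa using hc.integrable_of_hasCompactSupport hcs)
    (by simpa using hg.continuous.integrable_of_hasCompactSupport hs)
    (fun x _ => differentiableAt_const _) (fun x _ => hg.differentiable one_ne_zero x)
  simpa using h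

theorem isOpen_after (ε : ℝ) : IsOpen {p : Space × ℝ | ε < p.2} :=
  isOpen_lt continuous_const continuous_snd

theorem hasCompactSupport_of_ball {ρ : ℝ} {g : Space → ℂ} (hg : ∀ y, ρ < ‖y‖ → g y = 0) :
    HasCompactSupport g :=
  HasCompactSupport.intro (isCompact_closedBall (0 : Space) ρ) fun y hy => hg y (by simpa using hy)

theorem continuousOn_integral_slice {ε ρ : ℝ} {H : Space × ℝ → ℂ}
    (hH : ContinuousOn H {p | ε ≤ p.2}) (hs : ∀ p : Space × ℝ, ε ≤ p.2 → ρ < ‖p.1‖ → H p = 0) :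
    ContinuousOn (fun t => ∫ y, H (y, t)) (Set.Ici ε) := by
  refine continuousOn_integral_of_compact_support (f := fun t y => H (y, t))
    (isCompact_closedBall (0 : Space) ρ) ?_ ?_
  · exact hH.comp (by fun_prop) fun p hp => hp.1
  · intro t y ht hy
    exact hs (y, t) ht (by simpa using hy)

theorem slice_contDiff {ε : ℝ} {W : Space × ℝ → ℂ} (hW : ContDiffOn ℝ 1 W {p | ε < p.2})
    {t : ℝ} (ht : ε < t) : ContDiff ℝ 1 fun y => W (y, t) := by
  rw [contDiff_iff_contDiffAt]
  intro y
  have h : ContDiffAt ℝ 1 W (y, t) := hW.contDiffAt ((isOpen_after ε).mem_nhds ht)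
  exact h.comp (f := fun y => (y, t)) y (by fun_prop)

theorem hasDerivAt_slice {ε : ℝ} {H : Space × ℝ → ℂ} (hH : ContDiffOn ℝ 1 H {p | ε < p.2})
    (y : Space) {t : ℝ} (ht : ε < t) :
    HasDerivAt (fun s => H (y, s)) (fderiv ℝ H (y, t) (0, 1)) t := by
  have h : DifferentiableAt ℝ H (y, t) :=
    (hH.contDiffAt ((isOpen_after ε).mem_nhds ht)).differentiableAt one_ne_zero
  exact h.hasFDerivAt.comp_hasDerivAt (f := fun s => (y, s)) t
    ((hasDerivAt_const t y).prodMk (hasDerivAt_id t))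

theorem hasDerivAt_integral_slice {ε ρ : ℝ} {H : Space × ℝ → ℂ}
    (hH : ContDiffOn ℝ 1 H {p | ε < p.2})
    (hs : ∀ p : Space × ℝ, ε < p.2 → ρ < ‖p.1‖ → H p = 0) {t : ℝ} (ht : ε < t) :
    HasDerivAt (fun s => ∫ y, H (y, s)) (∫ y, deriv (fun s => H (y, s)) t) t := by
  have hc : ContinuousOn (fun p => fderiv ℝ H p (0, 1)) {p : Space × ℝ | ε < p.2} :=
    (hH.continuousOn_fderiv_of_isOpen (isOpen_after ε) le_rfl).clm_apply continuousOn_const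
  obtain ⟨η, hη, hηt⟩ : ∃ η > 0, ε < t - η := ⟨(t - ε) / 2, by linarith, by linarith⟩
  have hIcc : ∀ s ∈ Set.Icc (t - η) (t + η), ε < s := fun s hs => hηt.trans_le hs.1
  obtain ⟨C, hC⟩ := ((isCompact_closedBall (0 : Space) ρ).prod
    (isCompact_Icc (a := t - η) (b := t + η))).exists_bound_of_continuousOn
      (hc.mono fun p hp => hIcc p.2 hp.2)
  have hz : ∀ y s, ε < s → ρ < ‖y‖ → deriv (fun s => H (y, s)) s = 0 := by
    intro y s hs' hy
    have : (fun s => H (y, s)) =ᶠ[nhds s] fun _ => 0 := by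
      filter_upwards [Ioi_mem_nhds hs'] with u hu using hs (y, u) hu hy
    rw [this.deriv_eq]; simp
  refine (hasDerivAt_integral_of_dominated_loc_of_deriv_le (μ := MeasureTheory.volume)
    (s := Set.Icc (t - η) (t + η)) (F := fun s y => H (y, s))
    (F' := fun s y => deriv (fun s => H (y, s)) s)
    (bound := (Metric.closedBall (0 : Space) ρ).indicator fun _ => C)
    (Icc_mem_nhds (by linarith) (by linarith)) ?_ ?_ ?_ ?_ ?_ ?_).2
  · filter_upwards [Ioi_mem_nhds ht] with s hs'
    exact (slice_contDiff hH hs').continuous.aestronglyMeasurable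
  · exact (slice_contDiff hH ht).continuous.integrable_of_hasCompactSupport
      (hasCompactSupport_of_ball fun y hy => hs (y, t) ht hy)
  · have : (fun y => deriv (fun s => H (y, s)) t) = fun y => fderiv ℝ H (y, t) (0, 1) :=
      funext fun y => (hasDerivAt_slice hH y ht).deriv
    rw [this]
    have h2 : Continuous fun y : Space => fderiv ℝ H (y, t) (0, 1) :=
      continuousOn_univ.1 (hc.comp (f := fun y : Space => (y, t)) (by fun_prop) fun y _ => ht)
    exact h2.aestronglyMeasurable
  · refine Filter.Eventually.of_forall fun y s hs' => ?_
    by_cases hy : y ∈ Metric.closedBall (0 : Space) ρ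
    · rw [Set.indicator_of_mem hy, (hasDerivAt_slice hH y (hIcc s hs')).deriv]
      exact hC (y, s) ⟨hy, hs'⟩
    · rw [Set.indicator_of_notMem hy, hz y s (hIcc s hs') (by simpa using hy), norm_zero]
  · refine (MeasureTheory.integrable_indicator_iff
      Metric.isClosed_closedBall.measurableSet).2 ?_
    exact MeasureTheory.integrableOn_const (isCompact_closedBall _ _).measure_ne_top
  · exact Filter.Eventually.of_forall fun y s hs' =>
      (hasDerivAt_slice hH y (hIcc s hs')).differentiableAt.hasDerivAt

/-- The integrated form of the conservation law `∂ₜH + div W = D` for fields with spatially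
compact support. -/
theorem integral_of_conservation_law {ε t₁ ρ : ℝ} (ht₁ : ε ≤ t₁) {H D : Space × ℝ → ℂ}
    {W : Fin 3 → Space × ℝ → ℂ} (hHc : ContinuousOn H {p | ε ≤ p.2})
    (hH : ContDiffOn ℝ 1 H {p | ε < p.2}) (hW : ∀ k, ContDiffOn ℝ 1 (W k) {p | ε < p.2})
    (hD : ContinuousOn D {p | ε ≤ p.2})
    (hHs : ∀ p : Space × ℝ, ε ≤ p.2 → ρ < ‖p.1‖ → H p = 0)
    (hWs : ∀ k, ∀ p : Space × ℝ, ε < p.2 → ρ < ‖p.1‖ → W k p = 0)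
    (hDs : ∀ p : Space × ℝ, ε ≤ p.2 → ρ < ‖p.1‖ → D p = 0)
    (hlaw : ∀ y t, ε < t → deriv (fun s => H (y, s)) t +
      ∑ k, fderiv ℝ (fun z => W k (z, t)) y (EuclideanSpace.single k 1) = D (y, t)) :
    ∫ t in ε..t₁, ∫ y, D (y, t) = (∫ y, H (y, t₁)) - ∫ y, H (y, ε) := by
  -- This form asks for derivatives only on the open interval, matching solutions that are merely
  -- continuous up to `t = ε`.
  refine intervalIntegral.integral_eq_sub_of_hasDeriv_right_of_le ht₁
    (f := fun t => ∫ y, H (y, t)) ((continuousOn_integral_slice hHc hHs).mono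
      Set.Icc_subset_Ici_self) (fun t ht => ?_) ?_
  · refine HasDerivAt.hasDerivWithinAt ?_
    have h := hasDerivAt_integral_slice hH (fun p hp => hHs p hp.le) ht.1
    convert! h using 1
    have hcs : ∀ k, HasCompactSupport fun y => W k (y, t) := fun k =>
      hasCompactSupport_of_ball fun y hy => hWs k (y, t) ht.1 hy
    have hDcont : Continuous fun y : Space => D (y, t) :=
      continuousOn_univ.1 (hD.comp (f := fun y : Space => (y, t)) (by fun_prop)
        fun y _ => ht.1.le)
    have hDint : MeasureTheory.Integrable fun y : Space => D (y, t) :=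
      hDcont.integrable_of_hasCompactSupport
        (hasCompactSupport_of_ball fun y hy => hDs (y, t) ht.1.le hy)
    have hWint : ∀ k, MeasureTheory.Integrable fun y : Space =>
        fderiv ℝ (fun z => W k (z, t)) y (EuclideanSpace.single k 1) := fun k =>
      (((slice_contDiff (hW k) ht.1).continuous_fderiv one_ne_zero).clm_apply
        continuous_const).integrable_of_hasCompactSupport ((hcs k).fderiv_apply ℝ _)
    have hrew : (fun y => deriv (fun s => H (y, s)) t) = fun y => D (y, t) -
        ∑ k, fderiv ℝ (fun z => W k (z, t)) y (EuclideanSpace.single k 1) :=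
      funext fun y => eq_sub_of_add_eq (hlaw y t ht.1)
    rw [hrew, MeasureTheory.integral_sub hDint (MeasureTheory.integrable_finsetSum _
      fun k _ => hWint k), MeasureTheory.integral_finsetSum _ fun k _ => hWint k]
    simp [fun k => integral_fderiv_apply_eq_zero (slice_contDiff (hW k) ht.1) (hcs k)]
  · refine ContinuousOn.intervalIntegrable ?_
    rw [Set.uIcc_of_le ht₁]
    exact (continuousOn_integral_slice hD hDs).mono Set.Icc_subset_Ici_self

/-! ### The Dirac equation in components -/

/-- The partial derivative of `f` at `(y, t)` in the `k`-th spatial direction. -/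
def spaceDeriv (k : Fin 3) (f : Space × ℝ → ℂ) (y : Space) (t : ℝ) : ℂ :=
  fderiv ℝ (fun z => f (z, t)) y (EuclideanSpace.single k 1)

/-- The components `ψ₀, …, ψ₃` solve the Dirac equation for `t > ε`, solved for the time
derivatives. -/
structure IsComponentSolution (a₀ ℓ : ℝ) (m : ℂ) (ε : ℝ) (ψ : Fin 4 → Space × ℝ → ℂ) :
    Prop where
  continuousOn : ∀ i, ContinuousOn (ψ i) {p | ε ≤ p.2}
  contDiffOn : ∀ i, ContDiffOn ℝ 1 (ψ i) {p | ε < p.2}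
  eq_zero : ∀ y t, ε < t → deriv (fun s => ψ 0 (y, s)) t =
    -(1 / (scaleFactor a₀ ℓ t : ℂ)) *
      (spaceDeriv 0 (ψ 3) y t - I * spaceDeriv 1 (ψ 3) y t + spaceDeriv 2 (ψ 2) y t)
    - (3 * ℓ / (2 * t) + I * m / t) * ψ 0 (y, t)
  eq_one : ∀ y t, ε < t → deriv (fun s => ψ 1 (y, s)) t =
    -(1 / (scaleFactor a₀ ℓ t : ℂ)) *
      (spaceDeriv 0 (ψ 2) y t + I * spaceDeriv 1 (ψ 2) y t - spaceDeriv 2 (ψ 3) y t)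
    - (3 * ℓ / (2 * t) + I * m / t) * ψ 1 (y, t)
  eq_two : ∀ y t, ε < t → deriv (fun s => ψ 2 (y, s)) t =
    -(1 / (scaleFactor a₀ ℓ t : ℂ)) *
      (spaceDeriv 0 (ψ 1) y t - I * spaceDeriv 1 (ψ 1) y t + spaceDeriv 2 (ψ 0) y t)
    - (3 * ℓ / (2 * t) - I * m / t) * ψ 2 (y, t)
  eq_three : ∀ y t, ε < t → deriv (fun s => ψ 3 (y, s)) t =
    -(1 / (scaleFactor a₀ ℓ t : ℂ)) *
      (spaceDeriv 0 (ψ 0) y t + I * spaceDeriv 1 (ψ 0) y t - spaceDeriv 2 (ψ 1) y t)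
    - (3 * ℓ / (2 * t) - I * m / t) * ψ 3 (y, t)

/-- Exchanging the upper and the lower components changes the sign of the mass. -/
theorem IsComponentSolution.swap {a₀ ℓ : ℝ} {m : ℂ} {ε : ℝ} {ψ : Fin 4 → Space × ℝ → ℂ}
    (h : IsComponentSolution a₀ ℓ m ε ψ) :
    IsComponentSolution a₀ ℓ (-m) ε fun i => ψ (i + 2) where
  continuousOn i := h.continuousOn _
  contDiffOn i := h.contDiffOn _
  eq_zero y t ht := (h.eq_two y t ht).trans (by simp; left; ring)
  eq_one y t ht := (h.eq_three y t ht).trans (by simp; left; ring)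
  eq_two y t ht := (h.eq_zero y t ht).trans (by simp; left; ring)
  eq_three y t ht := (h.eq_one y t ht).trans (by simp; left; ring)

/-- The translation by `x` moves the point of evaluation to the origin, so that radial test
functions can be used. -/
theorem IsSolution.components {a₀ ℓ : ℝ} (ha₀ : 0 < a₀) {m : ℂ} {ε : ℝ} (hε : 0 < ε)
    {Φ : Space → Spinor} {Ψ : Space → ℝ → Spinor} (h : IsSolution a₀ ℓ m ε Φ Ψ) (x : Space) :
    IsComponentSolution a₀ ℓ m ε fun i p => Ψ (x + p.1) p.2 i := by
  have hC : ContDiffOn ℝ 1 (fun p : Space × ℝ => Ψ (x + p.1) p.2) {p | ε < p.2} :=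
    h.contDiffOn.comp (f := fun p : Space × ℝ => (x + p.1, p.2)) (by fun_prop) fun p hp => hp
  have key : ∀ y t, ε < t → ∃ (dt : Spinor) (dx : Fin 3 → Spinor),
      diracOp a₀ ℓ m Ψ (x + y) t = I • (gammaMatrix 0 *ᵥ dt)
        + ∑ k : Fin 3, (I / (scaleFactor a₀ ℓ t : ℂ)) • (gammaMatrix k.succ *ᵥ dx k)
        + (I * (3 * (ℓ / t) / 2)) • (gammaMatrix 0 *ᵥ Ψ (x + y) t)
        - (m / (t : ℂ)) • Ψ (x + y) t ∧
      (∀ i, deriv (fun s => Ψ (x + y) s i) t = dt i) ∧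
      ∀ k i, spaceDeriv k (fun p => Ψ (x + p.1) p.2 i) y t = dx k i := by
    intro y t ht
    have ht0 : 0 < t := hε.trans ht
    have hd : DifferentiableAt ℝ (fun p : Space × ℝ => Ψ (x + p.1) p.2) (y, t) :=
      (hC.contDiffAt ((isOpen_after ε).mem_nhds ht)).differentiableAt one_ne_zero
    have hdt : DifferentiableAt ℝ (fun s => Ψ (x + y) s) t :=
      hd.comp (f := fun s : ℝ => (y, s)) t (by fun_prop)
    have hdx : DifferentiableAt ℝ (fun z => Ψ (x + z) t) y :=
      hd.comp (f := fun z : Space => (z, t)) y (by fun_prop)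
    refine ⟨deriv (fun s => Ψ (x + y) s) t,
      fun k => fderiv ℝ (fun z => Ψ (x + z) t) y (EuclideanSpace.single k 1), ?_, ?_, ?_⟩
    · rw [diracOp, (scaleFactor_hasDerivAt a₀ ℓ ht0).deriv]
      have ha : (scaleFactor a₀ ℓ t : ℂ) ≠ 0 := by
        exact_mod_cast (scaleFactor_pos ha₀ ℓ ht0).ne'
      have e : (I * (3 * ((ℓ / t * scaleFactor a₀ ℓ t : ℝ) : ℂ) /
          (2 * (scaleFactor a₀ ℓ t : ℂ)))) = I * (3 * (ℓ / t) / 2) := by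
        push_cast; field_simp
      rw [e]
      have e2 := fderiv_comp_add_left (𝕜 := ℝ) (f := fun z => Ψ z t) (x := y) x
      simp only [e2]
    · exact fun i => ((hasDerivAt_pi.1 hdt.hasDerivAt) i).deriv
    · intro k i
      have := (hasFDerivAt_pi'.1 hdx.hasFDerivAt i).fderiv
      rw [spaceDeriv, this]
      simp
  refine ⟨fun i => ?_, fun i => ?_, ?_, ?_, ?_, ?_⟩
  · have : ContinuousOn (fun p : Space × ℝ => Ψ (x + p.1) p.2) {p | ε ≤ p.2} :=
      h.continuousOn.comp (f := fun p : Space × ℝ => (x + p.1, p.2)) (by fun_prop) fun p hp => hp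
    exact continuousOn_pi.1 this i
  · exact contDiffOn_pi.1 hC i
  all_goals
    intro y t ht
    obtain ⟨dt, dx, he, h1, h2⟩ := key y t ht
    rw [h.equation _ _ ht] at he
    simp only [h1, h2]
    have ht0 : (t : ℂ) ≠ 0 := by exact_mod_cast (hε.trans ht).ne'
    have ha : (scaleFactor a₀ ℓ t : ℂ) ≠ 0 := by
      exact_mod_cast (scaleFactor_pos ha₀ ℓ (hε.trans ht)).ne'
  · have := congrFun he 0
    simp [gammaMatrix, Fin.sum_univ_three, dotProduct, Fin.sum_univ_four] at this
    linear_combination I * this +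
      (dt 0 + (1 / (scaleFactor a₀ ℓ t : ℂ)) * (dx 0 3 - I * dx 1 3 + dx 2 2)
        + 3 * ℓ / (2 * t) * Ψ (x + y) t 0) * I_sq
  · have := congrFun he 1
    simp [gammaMatrix, Fin.sum_univ_three, dotProduct, Fin.sum_univ_four] at this
    linear_combination I * this +
      (dt 1 + (1 / (scaleFactor a₀ ℓ t : ℂ)) * (dx 0 2 + I * dx 1 2 - dx 2 3)
        + 3 * ℓ / (2 * t) * Ψ (x + y) t 1) * I_sq
  · have := congrFun he 2
    simp [gammaMatrix, Fin.sum_univ_three, dotProduct, Fin.sum_univ_four] at this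
    linear_combination -I * this +
      (dt 2 + (1 / (scaleFactor a₀ ℓ t : ℂ)) * (dx 0 1 - I * dx 1 1 + dx 2 0)
        + 3 * ℓ / (2 * t) * Ψ (x + y) t 2) * I_sq
  · have := congrFun he 3
    simp [gammaMatrix, Fin.sum_univ_three, dotProduct, Fin.sum_univ_four] at this
    linear_combination -I * this +
      (dt 3 + (1 / (scaleFactor a₀ ℓ t : ℂ)) * (dx 0 0 + I * dx 1 0 - dx 2 1)
        + 3 * ℓ / (2 * t) * Ψ (x + y) t 3) * I_sq

/-! ### Cut-off radial test functions -/

/-- A smooth monotone function that vanishes on `(-∞, 1]` and equals `1` on `[2, ∞)`. -/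
def cutoff (s : ℝ) : ℝ := Real.smoothTransition (s - 1)

theorem cutoff_contDiff : ContDiff ℝ 2 cutoff :=
  Real.smoothTransition.contDiff.comp (contDiff_id.sub contDiff_const)

theorem cutoff_of_le {s : ℝ} (hs : s ≤ 1) : cutoff s = 0 :=
  Real.smoothTransition.zero_of_nonpos (by linarith)

theorem cutoff_of_ge {s : ℝ} (hs : 2 ≤ s) : cutoff s = 1 :=
  Real.smoothTransition.one_of_one_le (by linarith)

theorem cutoff_hasDerivAt (s : ℝ) : HasDerivAt cutoff (deriv cutoff s) s :=
  (cutoff_contDiff.differentiable two_ne_zero s).hasDerivAt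

theorem continuous_deriv_cutoff : Continuous (deriv cutoff) :=
  cutoff_contDiff.continuous_deriv one_le_two

theorem deriv_cutoff_of_le {s : ℝ} (hs : s ≤ 1) : deriv cutoff s = 0 := by
  refine IsLocalMin.deriv_eq_zero (Filter.Eventually.of_forall fun u => ?_)
  rw [cutoff_of_le hs]; exact Real.smoothTransition.nonneg _

theorem deriv_cutoff_of_ge {s : ℝ} (hs : 2 ≤ s) : deriv cutoff s = 0 := by
  refine IsLocalMax.deriv_eq_zero (Filter.Eventually.of_forall fun u => ?_)
  rw [cutoff_of_ge hs]; exact Real.smoothTransition.le_one _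

theorem deriv_cutoff_nonneg (s : ℝ) : 0 ≤ deriv cutoff s :=
  Monotone.deriv_nonneg fun _ _ h => Real.smoothTransition.monotone (sub_le_sub_right h 1)

theorem exists_deriv_cutoff_ne_zero : ∃ s, 1 < s ∧ deriv cutoff s ≠ 0 := by
  obtain ⟨s, hs, h⟩ := exists_deriv_eq_slope cutoff one_lt_two
    cutoff_contDiff.continuous.continuousOn (cutoff_contDiff.differentiable two_ne_zero).differentiableOn
  refine ⟨s, hs.1, ?_⟩
  rw [h, cutoff_of_le le_rfl, cutoff_of_ge le_rfl]; norm_num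

/-- The function `t ^ (3ℓ/2) F(‖y‖, t) / ‖y‖ ^ k`, cut off near `y = 0`. -/
def radialTest (ℓ δ : ℝ) (F : ℝ → ℝ → ℂ) (k : ℕ) (p : Space × ℝ) : ℂ :=
  ((cutoff (‖p.1‖ ^ 2 / δ ^ 2) * p.2 ^ (3 * ℓ / 2) : ℝ) : ℂ) * F ‖p.1‖ p.2 / (‖p.1‖ : ℂ) ^ k

theorem radialTest_zero_of_lt {ℓ δ : ℝ} (hδ : 0 < δ) {F : ℝ → ℝ → ℂ} {k : ℕ} {p : Space × ℝ}
    (hp : ‖p.1‖ < δ) : radialTest ℓ δ F k p = 0 := by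
  have : ‖p.1‖ ^ 2 / δ ^ 2 ≤ 1 := by
    rw [div_le_one (by positivity)]
    exact pow_le_pow_left₀ (norm_nonneg _) hp.le 2
  simp [radialTest, cutoff_of_le this]

/-- The cut-off removes the only singularity: the function is identically zero for `‖y‖ < δ`, and
the norm is smooth away from `0`. -/
theorem radialTest_contDiffOn {ℓ δ : ℝ} (hδ : 0 < δ) {F : ℝ → ℝ → ℂ}
    (hF : ContDiffOn ℝ 1 (fun p : ℝ × ℝ => F p.1 p.2) {p | 0 < p.2}) (k : ℕ) :
    ContDiffOn ℝ 1 (radialTest ℓ δ F k) {p | 0 < p.2} := by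
  intro p hp
  apply ContDiffAt.contDiffWithinAt
  by_cases h0 : p.1 = 0
  · have : radialTest ℓ δ F k =ᶠ[nhds p] fun _ => 0 := by
      have ho : IsOpen {q : Space × ℝ | ‖q.1‖ < δ} :=
        isOpen_lt (by fun_prop) continuous_const
      filter_upwards [ho.mem_nhds (by simpa [h0] using hδ)] with q hq
      exact radialTest_zero_of_lt hδ hq
    exact contDiffAt_const.congr_of_eventuallyEq this
  · have hn : ContDiffAt ℝ 1 (fun q : Space × ℝ => ‖q.1‖) p := contDiffAt_fst.norm ℝ h0
    have hopen : IsOpen {q : ℝ × ℝ | 0 < q.2} := isOpen_lt continuous_const continuous_snd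
    have hF' : ContDiffAt ℝ 1 (fun q : Space × ℝ => F ‖q.1‖ q.2) p :=
      ContDiffAt.comp (g := fun q : ℝ × ℝ => F q.1 q.2) (f := fun q : Space × ℝ => (‖q.1‖, q.2)) p
        (hF.contDiffAt (hopen.mem_nhds hp)) (hn.prodMk contDiffAt_snd)
    have hc : ContDiffAt ℝ 1 (fun q : Space × ℝ => cutoff (‖q.1‖ ^ 2 / δ ^ 2)) p :=
      ContDiffAt.comp (g := cutoff) (f := fun q : Space × ℝ => ‖q.1‖ ^ 2 / δ ^ 2) p
        (cutoff_contDiff.of_le one_le_two).contDiffAt ((hn.pow 2).div_const _)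
    have hA : ContDiffAt ℝ 1 (fun q : Space × ℝ => q.2 ^ (3 * ℓ / 2)) p :=
      contDiffAt_snd.rpow_const_of_ne (ne_of_gt hp)
    have ho : ∀ {f : Space × ℝ → ℝ}, ContDiffAt ℝ 1 f p → ContDiffAt ℝ 1 (fun q => (f q : ℂ)) p :=
      fun hf => Complex.ofRealCLM.contDiff.contDiffAt.comp p hf
    have hk : (‖p.1‖ : ℂ) ^ k ≠ 0 :=
      pow_ne_zero _ (by exact_mod_cast norm_ne_zero_iff.2 h0)
    exact ((ho (hc.mul hA)).mul hF').mul (((ho hn).pow k).inv hk)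

/-- A slice of a differentiable function is differentiable along coordinate lines. -/
theorem hasDerivAt_line {f : Space × ℝ → ℂ} {y : Space} {t : ℝ}
    (hf : DifferentiableAt ℝ f (y, t)) (j : Fin 3) :
    HasDerivAt (fun s : ℝ => f (y + s • EuclideanSpace.single j 1, t)) (spaceDeriv j f y t) 0 := by
  have h : DifferentiableAt ℝ (fun z => f (z, t)) y :=
    hf.comp (f := fun z : Space => (z, t)) y (by fun_prop)
  exact h.hasFDerivAt.hasLineDerivAt _

theorem radialTest_hasDerivAt_time {ℓ δ : ℝ} {F : ℝ → ℝ → ℂ}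
    (hF : ContDiffOn ℝ 1 (fun p : ℝ × ℝ => F p.1 p.2) {p | 0 < p.2}) (k : ℕ) (y : Space) {t : ℝ}
    (ht : 0 < t) :
    HasDerivAt (fun s => radialTest ℓ δ F k (y, s))
      (((cutoff (‖y‖ ^ 2 / δ ^ 2) * t ^ (3 * ℓ / 2) : ℝ) : ℂ) *
        (3 * ℓ / (2 * t) * F ‖y‖ t + deriv (fun s => F ‖y‖ s) t) / (‖y‖ : ℂ) ^ k) t := by
  have hopen : IsOpen {q : ℝ × ℝ | 0 < q.2} := isOpen_lt continuous_const continuous_snd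
  have hFt : DifferentiableAt ℝ (fun s => F ‖y‖ s) t :=
    ((hF.contDiffAt (hopen.mem_nhds (x := (‖y‖, t)) ht)).differentiableAt one_ne_zero).comp
      (f := fun s : ℝ => (‖y‖, s)) t (by fun_prop)
  have hA : HasDerivAt (fun s : ℝ => ((cutoff (‖y‖ ^ 2 / δ ^ 2) * s ^ (3 * ℓ / 2) : ℝ) : ℂ))
      ((cutoff (‖y‖ ^ 2 / δ ^ 2) * t ^ (3 * ℓ / 2) : ℝ) * (3 * ℓ / (2 * t))) t := by
    have := ((Real.hasDerivAt_rpow_const (p := 3 * ℓ / 2) (Or.inl ht.ne')).const_mul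
      (cutoff (‖y‖ ^ 2 / δ ^ 2))).ofReal_comp
    convert! this using 1
    rw [Real.rpow_sub_one ht.ne']
    push_cast; ring
  convert! (hA.mul hFt.hasDerivAt).div_const ((‖y‖ : ℂ) ^ k) using 1
  ring

theorem hasDerivAt_norm_line {y : Space} (hy : y ≠ 0) (j : Fin 3) :
    HasDerivAt (fun s : ℝ => ‖y + s • EuclideanSpace.single j (1 : ℝ)‖) (y j / ‖y‖) 0 := by
  have h1 : HasDerivAt (fun s : ℝ => y + s • EuclideanSpace.single j (1 : ℝ))
      (EuclideanSpace.single j (1 : ℝ)) 0 := by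
    simpa using ((hasDerivAt_id (0 : ℝ)).smul_const (EuclideanSpace.single j (1 : ℝ))).const_add y
  have h2 := h1.norm_sq.sqrt (by simpa using hy)
  simp only [Real.sqrt_sq (norm_nonneg _)] at h2
  convert! h2 using 1
  simp [EuclideanSpace.inner_single_right]
  field_simp

theorem radialTest_spaceDeriv {ℓ δ : ℝ} (hδ : 0 < δ) {F : ℝ → ℝ → ℂ}
    (hF : ContDiffOn ℝ 1 (fun p : ℝ × ℝ => F p.1 p.2) {p | 0 < p.2}) (k : ℕ) (y : Space) {t : ℝ}
    (ht : 0 < t) (j : Fin 3) :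
    spaceDeriv j (radialTest ℓ δ F k) y t = y j * ((t ^ (3 * ℓ / 2) : ℝ) *
      ((deriv cutoff (‖y‖ ^ 2 / δ ^ 2) : ℝ) * (2 / δ ^ 2) * F ‖y‖ t / (‖y‖ : ℂ) ^ k
        + (cutoff (‖y‖ ^ 2 / δ ^ 2) : ℝ) * (deriv (fun r => F r t) ‖y‖ / (‖y‖ : ℂ) ^ (k + 1)
          - k * F ‖y‖ t / (‖y‖ : ℂ) ^ (k + 2)))) := by
  have hopen' : IsOpen {q : Space × ℝ | 0 < q.2} := isOpen_after 0
  have hl := hasDerivAt_line (((radialTest_contDiffOn (ℓ := ℓ) hδ hF k).contDiffAt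
    (hopen'.mem_nhds (x := (y, t)) ht)).differentiableAt one_ne_zero) j
  -- At the origin the formula holds because of its factor `y j`, whatever the quotients by zero
  -- mean.
  by_cases hy : y = 0
  · subst hy
    have h0 : HasDerivAt (fun s : ℝ => radialTest ℓ δ F k
        ((0 : Space) + s • EuclideanSpace.single j 1, t)) 0 0 := by
      refine (hasDerivAt_const (0 : ℝ) (0 : ℂ)).congr_of_eventuallyEq ?_
      have hc : ContinuousAt (fun s : ℝ => ‖(0 : Space) + s • EuclideanSpace.single j (1 : ℝ)‖) 0 :=
        by fun_prop
      filter_upwards [hc.eventually_lt continuousAt_const (by simpa using hδ)] with s hs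
      exact radialTest_zero_of_lt hδ hs
    rw [hl.unique h0]; simp
  have hopen : IsOpen {q : ℝ × ℝ | 0 < q.2} := isOpen_lt continuous_const continuous_snd
  have hFr : DifferentiableAt ℝ (fun r => F r t) ‖y‖ :=
    ((hF.contDiffAt (hopen.mem_nhds (x := (‖y‖, t)) ht)).differentiableAt one_ne_zero).comp
      (f := fun r : ℝ => (r, t)) ‖y‖ (by fun_prop)
  have hn := hasDerivAt_norm_line hy j
  have hr : (‖y‖ : ℂ) ≠ 0 := by exact_mod_cast norm_ne_zero_iff.2 hy
  have hC : HasDerivAt (fun r : ℝ => ((cutoff (r ^ 2 / δ ^ 2) * t ^ (3 * ℓ / 2) : ℝ) : ℂ))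
      ((deriv cutoff (‖y‖ ^ 2 / δ ^ 2) * (2 * ‖y‖ / δ ^ 2) * t ^ (3 * ℓ / 2) : ℝ)) ‖y‖ := by
    have h1 : HasDerivAt (fun r : ℝ => r ^ 2 / δ ^ 2) (2 * ‖y‖ / δ ^ 2) ‖y‖ := by
      simpa using (hasDerivAt_pow 2 ‖y‖).div_const (δ ^ 2)
    exact (((cutoff_hasDerivAt _).comp ‖y‖ h1).mul_const (t ^ (3 * ℓ / 2))).ofReal_comp
  have hP : HasDerivAt (fun r : ℝ => (r : ℂ) ^ k) (k * (‖y‖ : ℂ) ^ (k - 1)) ‖y‖ :=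
    (hasDerivAt_pow k (‖y‖ : ℂ)).comp_ofReal
  have hrad := ((hC.mul hFr.hasDerivAt).div hP (pow_ne_zero k hr))
  have h2 := HasDerivAt.scomp_of_eq (0 : ℝ) hrad hn (by simp)
  rw [hl.unique h2]
  have hk : (k : ℂ) * (‖y‖ : ℂ) ^ (k - 1) = k * (‖y‖ : ℂ) ^ k / ‖y‖ := by
    rcases k with _ | k
    · simp
    · field_simp; simp [pow_succ]
  rw [hk, Complex.real_smul]
  simp only [Pi.mul_apply]
  push_cast
  field_simp
  ring

/-! ### The conservation law for radial test functions -/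

/-- A radial solution `(P / r², Q / r)` of the adjoint Dirac equation, up to the weight
`t ^ (3ℓ/2)`. -/
structure RadialKernel (a₀ ℓ : ℝ) (m : ℂ) where
  /-- The coefficient of the upper components. -/
  P : ℝ → ℝ → ℂ
  /-- The coefficient of the lower components. -/
  Q : ℝ → ℝ → ℂ
  contDiffOn_P : ContDiffOn ℝ 1 (fun p : ℝ × ℝ => P p.1 p.2) {p | 0 < p.2}
  contDiffOn_Q : ContDiffOn ℝ 1 (fun p : ℝ × ℝ => Q p.1 p.2) {p | 0 < p.2}
  deriv_P : ∀ r t, 0 < t → deriv (fun s => P r s) t =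
    I * m / t * P r t - 1 / (scaleFactor a₀ ℓ t : ℂ) * (r * deriv (fun s => Q s t) r - Q r t)
  -- With `u = P / r²` and `v = Q / r`, the two relations are the radial system `∂ₜu = (i m / t) u -
  -- v_r / a`, `∂ₜv = -(i m / t) v - (r² u)_r / (a r²)`, cleared of denominators in `r`.
  deriv_Q : ∀ r t, 0 < t → r * deriv (fun s => Q r s) t =
    -(I * m / t) * (r * Q r t) - 1 / (scaleFactor a₀ ℓ t : ℂ) * deriv (fun s => P s t) r

/-- The first component of the row vector `(e₁, e₂) (y · σ)`. -/
def pauliFst (e₁ e₂ : ℂ) (y : Space) : ℂ := e₁ * (y 2 : ℝ) + e₂ * ((y 0 : ℝ) + I * (y 1 : ℝ))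

/-- The second component of the row vector `(e₁, e₂) (y · σ)`. -/
def pauliSnd (e₁ e₂ : ℂ) (y : Space) : ℂ := e₁ * ((y 0 : ℝ) - I * (y 1 : ℝ)) - e₂ * (y 2 : ℝ)

theorem pauliFst_contDiff (e₁ e₂ : ℂ) : ContDiff ℝ 1 (pauliFst e₁ e₂) := by
  have h : ∀ j : Fin 3, ContDiff ℝ 1 fun y : Space => ((y j : ℝ) : ℂ) := fun j =>
    Complex.ofRealCLM.contDiff.comp (by fun_prop)
  exact (contDiff_const.mul (h 2)).add (contDiff_const.mul ((h 0).add (contDiff_const.mul (h 1))))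

theorem pauliSnd_contDiff (e₁ e₂ : ℂ) : ContDiff ℝ 1 (pauliSnd e₁ e₂) := by
  have h : ∀ j : Fin 3, ContDiff ℝ 1 fun y : Space => ((y j : ℝ) : ℂ) := fun j =>
    Complex.ofRealCLM.contDiff.comp (by fun_prop)
  exact (contDiff_const.mul ((h 0).sub (contDiff_const.mul (h 1)))).sub (contDiff_const.mul (h 2))

theorem pauliFst_line (e₁ e₂ : ℂ) (y v : Space) :
    HasDerivAt (fun s : ℝ => pauliFst e₁ e₂ (y + s • v)) (pauliFst e₁ e₂ v) 0 := by
  have h : (fun s : ℝ => pauliFst e₁ e₂ (y + s • v)) =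
      fun s : ℝ => pauliFst e₁ e₂ y + (s : ℂ) * pauliFst e₁ e₂ v := by
    ext s; simp [pauliFst]; ring
  rw [h]
  simpa using ((hasDerivAt_id (0 : ℝ)).ofReal_comp.mul_const (pauliFst e₁ e₂ v)).const_add
    (pauliFst e₁ e₂ y)

theorem pauliSnd_line (e₁ e₂ : ℂ) (y v : Space) :
    HasDerivAt (fun s : ℝ => pauliSnd e₁ e₂ (y + s • v)) (pauliSnd e₁ e₂ v) 0 := by
  have h : (fun s : ℝ => pauliSnd e₁ e₂ (y + s • v)) =
      fun s : ℝ => pauliSnd e₁ e₂ y + (s : ℂ) * pauliSnd e₁ e₂ v := by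
    ext s; simp [pauliSnd]; ring
  rw [h]
  simpa using ((hasDerivAt_id (0 : ℝ)).ofReal_comp.mul_const (pauliSnd e₁ e₂ v)).const_add
    (pauliSnd e₁ e₂ y)

section Fields

variable {a₀ ℓ : ℝ} {m : ℂ} (K : RadialKernel a₀ ℓ m) (δ : ℝ) (e₁ e₂ : ℂ)
  (ψ : Fin 4 → Space × ℝ → ℂ)

/-- The pairing of the test row vector with the spinor field. -/
def pairing (p : Space × ℝ) : ℂ :=
  radialTest ℓ δ K.P 3 p * (pauliFst e₁ e₂ p.1 * ψ 0 p + pauliSnd e₁ e₂ p.1 * ψ 1 p)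
    + radialTest ℓ δ K.Q 1 p * (e₁ * ψ 2 p + e₂ * ψ 3 p)

/-- The flux belonging to `pairing`. -/
def flux : Fin 3 → Space × ℝ → ℂ :=
  ![fun p => 1 / (scaleFactor a₀ ℓ p.2 : ℂ) *
      (radialTest ℓ δ K.P 3 p * (pauliFst e₁ e₂ p.1 * ψ 3 p + pauliSnd e₁ e₂ p.1 * ψ 2 p)
        + radialTest ℓ δ K.Q 1 p * (e₁ * ψ 1 p + e₂ * ψ 0 p)),
    fun p => 1 / (scaleFactor a₀ ℓ p.2 : ℂ) *
      (radialTest ℓ δ K.P 3 p *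
          (-I * (pauliFst e₁ e₂ p.1 * ψ 3 p) + I * (pauliSnd e₁ e₂ p.1 * ψ 2 p))
        + radialTest ℓ δ K.Q 1 p * (-I * (e₁ * ψ 1 p) + I * (e₂ * ψ 0 p))),
    fun p => 1 / (scaleFactor a₀ ℓ p.2 : ℂ) *
      (radialTest ℓ δ K.P 3 p * (pauliFst e₁ e₂ p.1 * ψ 2 p - pauliSnd e₁ e₂ p.1 * ψ 3 p)
        + radialTest ℓ δ K.Q 1 p * (e₁ * ψ 0 p - e₂ * ψ 1 p))]

/-- The defect of the conservation law, supported where the cut-off is not constant. -/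
def defect (p : Space × ℝ) : ℂ :=
  ((1 / scaleFactor a₀ ℓ p.2 * p.2 ^ (3 * ℓ / 2) : ℝ) : ℂ) *
    ((2 / δ ^ 2 * (deriv cutoff (‖p.1‖ ^ 2 / δ ^ 2) / ‖p.1‖) : ℝ) : ℂ) *
    (K.Q ‖p.1‖ p.2 * (pauliFst e₁ e₂ p.1 * ψ 0 p + pauliSnd e₁ e₂ p.1 * ψ 1 p)
      + K.P ‖p.1‖ p.2 * (e₁ * ψ 2 p + e₂ * ψ 3 p))

variable {K δ e₁ e₂ ψ} {ε : ℝ}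

theorem pairing_contDiffOn (hε : 0 < ε) (hδ : 0 < δ) (hψ : IsComponentSolution a₀ ℓ m ε ψ) :
    ContDiffOn ℝ 1 (pairing K δ e₁ e₂ ψ) {p | ε < p.2} := by
  have hn := (radialTest_contDiffOn (ℓ := ℓ) hδ K.contDiffOn_P 3).mono
    (fun p hp => hε.trans hp : {p : Space × ℝ | ε < p.2} ⊆ _)
  have hs := (radialTest_contDiffOn (ℓ := ℓ) hδ K.contDiffOn_Q 1).mono
    (fun p hp => hε.trans hp : {p : Space × ℝ | ε < p.2} ⊆ _)
  have hA : ContDiffOn ℝ 1 (fun p : Space × ℝ => pauliFst e₁ e₂ p.1) {p | ε < p.2} :=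
    ((pauliFst_contDiff e₁ e₂).comp contDiff_fst).contDiffOn
  have hB : ContDiffOn ℝ 1 (fun p : Space × ℝ => pauliSnd e₁ e₂ p.1) {p | ε < p.2} :=
    ((pauliSnd_contDiff e₁ e₂).comp contDiff_fst).contDiffOn
  have h := hψ.contDiffOn
  exact (hn.mul ((hA.mul (h 0)).add (hB.mul (h 1)))).add
    (hs.mul ((contDiffOn_const.mul (h 2)).add (contDiffOn_const.mul (h 3))))

theorem pairing_continuousOn (hε : 0 < ε) (hδ : 0 < δ) (hψ : IsComponentSolution a₀ ℓ m ε ψ) :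
    ContinuousOn (pairing K δ e₁ e₂ ψ) {p | ε ≤ p.2} := by
  have hn := (radialTest_contDiffOn (ℓ := ℓ) hδ K.contDiffOn_P 3).continuousOn.mono
    (fun p hp => hε.trans_le hp : {p : Space × ℝ | ε ≤ p.2} ⊆ _)
  have hs := (radialTest_contDiffOn (ℓ := ℓ) hδ K.contDiffOn_Q 1).continuousOn.mono
    (fun p hp => hε.trans_le hp : {p : Space × ℝ | ε ≤ p.2} ⊆ _)
  have hA : ContinuousOn (fun p : Space × ℝ => pauliFst e₁ e₂ p.1) {p | ε ≤ p.2} :=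
    ((pauliFst_contDiff e₁ e₂).continuous.comp continuous_fst).continuousOn
  have hB : ContinuousOn (fun p : Space × ℝ => pauliSnd e₁ e₂ p.1) {p | ε ≤ p.2} :=
    ((pauliSnd_contDiff e₁ e₂).continuous.comp continuous_fst).continuousOn
  have h := hψ.continuousOn
  exact (hn.mul ((hA.mul (h 0)).add (hB.mul (h 1)))).add
    (hs.mul ((continuousOn_const.mul (h 2)).add (continuousOn_const.mul (h 3))))

theorem inv_scaleFactor_contDiffOn (ha₀ : 0 < a₀) (hε : 0 < ε) :
    ContDiffOn ℝ 1 (fun p : Space × ℝ => 1 / (scaleFactor a₀ ℓ p.2 : ℂ)) {p | ε < p.2} := by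
  intro p hp
  have hp0 : 0 < p.2 := hε.trans hp
  apply ContDiffAt.contDiffWithinAt
  have h1 : ContDiffAt ℝ 1 (fun q : Space × ℝ => scaleFactor a₀ ℓ q.2) p :=
    contDiffAt_const.mul (contDiffAt_snd.rpow_const_of_ne hp0.ne')
  have h2 : ContDiffAt ℝ 1 (fun q : Space × ℝ => (scaleFactor a₀ ℓ q.2 : ℂ)) p :=
    Complex.ofRealCLM.contDiff.contDiffAt.comp p h1
  simp only [one_div]
  exact h2.inv (by exact_mod_cast (scaleFactor_pos ha₀ ℓ hp0).ne')

theorem flux_contDiffOn (ha₀ : 0 < a₀) (hε : 0 < ε) (hδ : 0 < δ)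
    (hψ : IsComponentSolution a₀ ℓ m ε ψ) (k : Fin 3) :
    ContDiffOn ℝ 1 (flux K δ e₁ e₂ ψ k) {p | ε < p.2} := by
  have hn := (radialTest_contDiffOn (ℓ := ℓ) hδ K.contDiffOn_P 3).mono
    (fun p hp => hε.trans hp : {p : Space × ℝ | ε < p.2} ⊆ _)
  have hs := (radialTest_contDiffOn (ℓ := ℓ) hδ K.contDiffOn_Q 1).mono
    (fun p hp => hε.trans hp : {p : Space × ℝ | ε < p.2} ⊆ _)
  have hA : ContDiffOn ℝ 1 (fun p : Space × ℝ => pauliFst e₁ e₂ p.1) {p | ε < p.2} :=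
    ((pauliFst_contDiff e₁ e₂).comp contDiff_fst).contDiffOn
  have hB : ContDiffOn ℝ 1 (fun p : Space × ℝ => pauliSnd e₁ e₂ p.1) {p | ε < p.2} :=
    ((pauliSnd_contDiff e₁ e₂).comp contDiff_fst).contDiffOn
  have h := hψ.contDiffOn
  have hc := inv_scaleFactor_contDiffOn (ℓ := ℓ) ha₀ hε
  fin_cases k
  · exact hc.mul ((hn.mul ((hA.mul (h 3)).add (hB.mul (h 2)))).add
      (hs.mul ((contDiffOn_const.mul (h 1)).add (contDiffOn_const.mul (h 0)))))
  · exact hc.mul ((hn.mul ((contDiffOn_const.mul (hA.mul (h 3))).add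
      (contDiffOn_const.mul (hB.mul (h 2))))).add
      (hs.mul ((contDiffOn_const.mul (contDiffOn_const.mul (h 1))).add
        (contDiffOn_const.mul (contDiffOn_const.mul (h 0))))))
  · exact hc.mul ((hn.mul ((hA.mul (h 2)).sub (hB.mul (h 3)))).add
      (hs.mul ((contDiffOn_const.mul (h 0)).sub (contDiffOn_const.mul (h 1)))))

/-- The test row vector solves the adjoint equation except where the cut-off varies, so only terms
with the derivative of the cut-off survive. The weight `t ^ (3ℓ/2)` absorbs the expansion term of
the Dirac equation. -/
theorem conservation_law (ha₀ : 0 < a₀) (hε : 0 < ε) (hδ : 0 < δ)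
    (hψ : IsComponentSolution a₀ ℓ m ε ψ) (y : Space) {t : ℝ} (ht : ε < t) :
    deriv (fun s => pairing K δ e₁ e₂ ψ (y, s)) t +
      ∑ k, fderiv ℝ (fun z => flux K δ e₁ e₂ ψ k (z, t)) y (EuclideanSpace.single k 1) =
    defect K δ e₁ e₂ ψ (y, t) := by
  have ht0 : 0 < t := hε.trans ht
  have hmem : {p : Space × ℝ | ε < p.2} ∈ nhds (y, t) := (isOpen_after ε).mem_nhds ht
  have hmem0 : {p : Space × ℝ | 0 < p.2} ∈ nhds (y, t) := (isOpen_after 0).mem_nhds ht0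
  set n := radialTest ℓ δ K.P 3 with hn
  set q := radialTest ℓ δ K.Q 1 with hq
  -- The derivatives of the test functions are kept as opaque numbers, so that the spinor algebra
  -- can be separated from the radial equations.
  obtain ⟨nt, hnt, ent⟩ : ∃ d, HasDerivAt (fun s => n (y, s)) d t ∧ d = _ :=
    ⟨_, radialTest_hasDerivAt_time (δ := δ) (ℓ := ℓ) K.contDiffOn_P 3 y ht0, rfl⟩
  obtain ⟨qt, hqt, eqt⟩ : ∃ d, HasDerivAt (fun s => q (y, s)) d t ∧ d = _ :=
    ⟨_, radialTest_hasDerivAt_time (δ := δ) (ℓ := ℓ) K.contDiffOn_Q 1 y ht0, rfl⟩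
  obtain ⟨nr, hnr, enr⟩ : ∃ d : ℂ, (∀ j, spaceDeriv j n y t = y j * d) ∧ d = _ :=
    ⟨_, radialTest_spaceDeriv (ℓ := ℓ) hδ K.contDiffOn_P 3 y ht0, rfl⟩
  obtain ⟨qr, hqr, eqr⟩ : ∃ d : ℂ, (∀ j, spaceDeriv j q y t = y j * d) ∧ d = _ :=
    ⟨_, radialTest_spaceDeriv (ℓ := ℓ) hδ K.contDiffOn_Q 1 y ht0, rfl⟩
  have hnl (j) := hasDerivAt_line (((radialTest_contDiffOn (ℓ := ℓ) hδ K.contDiffOn_P 3).contDiffAt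
    hmem0).differentiableAt one_ne_zero) j
  have hql (j) := hasDerivAt_line (((radialTest_contDiffOn (ℓ := ℓ) hδ K.contDiffOn_Q 1).contDiffAt
    hmem0).differentiableAt one_ne_zero) j
  rw [← hn] at hnl
  rw [← hq] at hql
  simp only [hnr] at hnl
  simp only [hqr] at hql
  have hψt (i) : HasDerivAt (fun s => ψ i (y, s)) (deriv (fun s => ψ i (y, s)) t) t :=
    (hasDerivAt_slice (hψ.contDiffOn i) y ht).differentiableAt.hasDerivAt
  have hψl (i j) := hasDerivAt_line (((hψ.contDiffOn i).contDiffAt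
    hmem).differentiableAt one_ne_zero) j
  have hAl (j : Fin 3) := pauliFst_line e₁ e₂ y (EuclideanSpace.single j 1)
  have hBl (j : Fin 3) := pauliSnd_line e₁ e₂ y (EuclideanSpace.single j 1)
  have hfl (k) : HasDerivAt (fun s : ℝ => flux K δ e₁ e₂ ψ k
      (y + s • EuclideanSpace.single k 1, t))
      (fderiv ℝ (fun z => flux K δ e₁ e₂ ψ k (z, t)) y (EuclideanSpace.single k 1)) 0 :=
    hasDerivAt_line (((flux_contDiffOn ha₀ hε hδ hψ k).contDiffAt
      hmem).differentiableAt one_ne_zero) k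
  have eH := ((hnt.mul (((hψt 0).const_mul (pauliFst e₁ e₂ y)).add
    ((hψt 1).const_mul (pauliSnd e₁ e₂ y)))).add
    (hqt.mul (((hψt 2).const_mul e₁).add ((hψt 3).const_mul e₂)))).deriv
  have e0 := (hfl 0).unique ((((hnl 0).mul (((hAl 0).mul (hψl 3 0)).add
    ((hBl 0).mul (hψl 2 0)))).add ((hql 0).mul (((hψl 1 0).const_mul e₁).add
      ((hψl 0 0).const_mul e₂)))).const_mul (1 / (scaleFactor a₀ ℓ t : ℂ)))
  have e1 := (hfl 1).unique ((((hnl 1).mul ((((hAl 1).mul (hψl 3 1)).const_mul (-I)).add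
    (((hBl 1).mul (hψl 2 1)).const_mul I))).add ((hql 1).mul
      ((((hψl 1 1).const_mul e₁).const_mul (-I)).add
      (((hψl 0 1).const_mul e₂).const_mul I)))).const_mul (1 / (scaleFactor a₀ ℓ t : ℂ)))
  have e2 := (hfl 2).unique ((((hnl 2).mul (((hAl 2).mul (hψl 2 2)).sub
    ((hBl 2).mul (hψl 3 2)))).add ((hql 2).mul (((hψl 0 2).const_mul e₁).sub
      ((hψl 1 2).const_mul e₂)))).const_mul (1 / (scaleFactor a₀ ℓ t : ℂ)))
  simp at e0 e1 e2
  have e3 : deriv (fun s => pairing K δ e₁ e₂ ψ (y, s)) t = _ := eH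
  simp at e3
  rw [Fin.sum_univ_three, e0, e1, e2, e3, hψ.eq_zero y t ht, hψ.eq_one y t ht,
    hψ.eq_two y t ht, hψ.eq_three y t ht]
  have hr : (‖y‖ : ℂ) ^ 2 = (y 0 : ℂ) ^ 2 + (y 1 : ℂ) ^ 2 + (y 2 : ℂ) ^ 2 := by
    have : ‖y‖ ^ 2 = y 0 ^ 2 + y 1 ^ 2 + y 2 ^ 2 := by
      rw [EuclideanSpace.real_norm_sq_eq, Fin.sum_univ_three]
    exact_mod_cast this
  -- The adjoint radial equations for the cut-off kernel: `y * qr` is the gradient of `q`, and `‖y‖²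
  -- nr + 3 n` is the divergence of `n y`.
  have hrel : nt - (3 * ℓ / (2 * t) + I * m / t) * n (y, t)
        + 1 / (scaleFactor a₀ ℓ t : ℂ) * qr =
      ((1 / scaleFactor a₀ ℓ t * t ^ (3 * ℓ / 2) : ℝ) : ℂ) *
        ((2 / δ ^ 2 * (deriv cutoff (‖y‖ ^ 2 / δ ^ 2) / ‖y‖) : ℝ) : ℂ) * K.Q ‖y‖ t ∧
      qt - (3 * ℓ / (2 * t) - I * m / t) * q (y, t)
        + 1 / (scaleFactor a₀ ℓ t : ℂ) * ((‖y‖ : ℂ) ^ 2 * nr + 3 * n (y, t)) =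
      ((1 / scaleFactor a₀ ℓ t * t ^ (3 * ℓ / 2) : ℝ) : ℂ) *
        ((2 / δ ^ 2 * (deriv cutoff (‖y‖ ^ 2 / δ ^ 2) / ‖y‖) : ℝ) : ℂ) * K.P ‖y‖ t := by
    rw [ent, eqt, enr, eqr]
    simp only [hn, hq, radialTest]
    rcases eq_or_ne y 0 with rfl | hy
    -- At `y = 0` the cut-off vanishes and the quotients by `‖y‖` are `0` by convention.
    · simp [cutoff_of_le zero_le_one]
    · have hP := K.deriv_P ‖y‖ t ht0
      have hQ := K.deriv_Q ‖y‖ t ht0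
      have hy0 : (‖y‖ : ℂ) ≠ 0 := by exact_mod_cast norm_ne_zero_iff.2 hy
      have hQ' : deriv (fun s => K.Q ‖y‖ s) t = (-(I * m / t) * (‖y‖ * K.Q ‖y‖ t) -
          1 / (scaleFactor a₀ ℓ t : ℂ) * deriv (fun s => K.P s t) ‖y‖) / ‖y‖ := by
        rw [← hQ]; field_simp
      have ha : (scaleFactor a₀ ℓ t : ℂ) ≠ 0 := by
        exact_mod_cast (scaleFactor_pos ha₀ ℓ ht0).ne'
      have htc : (t : ℂ) ≠ 0 := by exact_mod_cast ht0.ne'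
      have hδc : (δ : ℂ) ≠ 0 := by exact_mod_cast hδ.ne'
      rw [hP, hQ']
      push_cast
      constructor <;> field_simp <;> ring
  obtain ⟨R1, R2⟩ := hrel
  simp only [defect]
  simp [pauliFst, pauliSnd] at R1 R2 ⊢
  -- The use of `hr` is the Pauli identity `(y · σ)² = ‖y‖²`.
  linear_combination ((e₁ * y 2 + e₂ * (y 0 + I * y 1)) * ψ 0 (y, t)
      + (e₁ * (y 0 - I * y 1) - e₂ * y 2) * ψ 1 (y, t)) * R1
    + (e₁ * ψ 2 (y, t) + e₂ * ψ 3 (y, t)) * R2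
    - 1 / (scaleFactor a₀ ℓ t : ℂ) * nr * (e₁ * ψ 2 (y, t) + e₂ * ψ 3 (y, t)) * hr
    - 1 / (scaleFactor a₀ ℓ t : ℂ) * (e₁ * ψ 2 (y, t) + e₂ * ψ 3 (y, t)) *
      (n (y, t) + nr * (y 1 : ℂ) ^ 2) * I_sq

end Fields

/-! ### Localization at the vertex of the cone -/

theorem continuous_deriv_cutoff_div (δ : ℝ) :
    Continuous fun y : Space => deriv cutoff (‖y‖ ^ 2 / δ ^ 2) / ‖y‖ := by
  rw [continuous_iff_continuousAt]
  intro y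
  by_cases hy : y = 0
  · subst hy
    have hc : ContinuousAt (fun y : Space => ‖y‖ ^ 2 / δ ^ 2) 0 := by fun_prop
    have : (fun y : Space => deriv cutoff (‖y‖ ^ 2 / δ ^ 2) / ‖y‖) =ᶠ[nhds 0] fun _ => 0 := by
      filter_upwards [hc.eventually_lt (continuousAt_const (y := (1 : ℝ))) (by simp)] with z hz
      rw [deriv_cutoff_of_le hz.le, zero_div]
    exact continuousAt_const.congr this.symm
  · have h1 : ContinuousAt (fun y : Space => deriv cutoff (‖y‖ ^ 2 / δ ^ 2)) y :=
      (continuous_deriv_cutoff.comp (by fun_prop)).continuousAt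
    exact h1.div (by fun_prop) (norm_ne_zero_iff.2 hy)

theorem integral_deriv_cutoff_pos :
    0 < ∫ z : Space, 2 * (deriv cutoff (‖z‖ ^ 2 / 1 ^ 2) / ‖z‖) := by
  have hc : Continuous fun z : Space => 2 * (deriv cutoff (‖z‖ ^ 2 / 1 ^ 2) / ‖z‖) :=
    continuous_const.mul (continuous_deriv_cutoff_div 1)
  obtain ⟨s, hs, hne⟩ := exists_deriv_cutoff_ne_zero
  have hs0 : 0 ≤ s := by linarith
  have hnorm : ‖EuclideanSpace.single (0 : Fin 3) (Real.sqrt s)‖ = Real.sqrt s := by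
    simp [abs_of_nonneg (Real.sqrt_nonneg s)]
  refine hc.integral_pos_of_hasCompactSupport_nonneg_nonzero ?_ (fun z => ?_)
    (x := EuclideanSpace.single (0 : Fin 3) (Real.sqrt s)) ?_
  · refine HasCompactSupport.intro (isCompact_closedBall (0 : Space) 2) fun z hz => ?_
    have hz2 : 2 < ‖z‖ := by simpa using hz
    rw [deriv_cutoff_of_ge (by nlinarith)]; simp
  · have := deriv_cutoff_nonneg (‖z‖ ^ 2 / 1 ^ 2)
    simp only [Pi.zero_apply]
    positivity
  · rw [hnorm, Real.sq_sqrt hs0, one_pow, div_one]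
    have : Real.sqrt s ≠ 0 := (Real.sqrt_pos.2 (by linarith)).ne'
    exact mul_ne_zero two_ne_zero (div_ne_zero hne this)

section Limit

variable {a₀ ℓ : ℝ} {m : ℂ} {K : RadialKernel a₀ ℓ m} {δ : ℝ} {e₁ e₂ : ℂ}
  {ψ : Fin 4 → Space × ℝ → ℂ} {ε : ℝ}

theorem weight_continuousOn (ha₀ : 0 < a₀) (hε : 0 < ε) :
    ContinuousOn (fun t : ℝ => ((1 / scaleFactor a₀ ℓ t * t ^ (3 * ℓ / 2) : ℝ) : ℂ))
      (Set.Ici ε) := by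
  intro t ht
  have ht0 : 0 < t := hε.trans_le ht
  apply ContinuousAt.continuousWithinAt
  have h1 : ContinuousAt (fun t : ℝ => 1 / scaleFactor a₀ ℓ t) t :=
    continuousAt_const.div (scaleFactor_hasDerivAt a₀ ℓ ht0).continuousAt
      (scaleFactor_pos ha₀ ℓ ht0).ne'
  have h2 : ContinuousAt (fun t : ℝ => t ^ (3 * ℓ / 2)) t :=
    Real.continuousAt_rpow_const _ _ (Or.inl ht0.ne')
  exact Complex.continuous_ofReal.continuousAt.comp (h1.mul h2)

theorem kernel_continuousOn {F : ℝ → ℝ → ℂ}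
    (hF : ContDiffOn ℝ 1 (fun p : ℝ × ℝ => F p.1 p.2) {p | 0 < p.2}) (hε : 0 < ε) :
    ContinuousOn (fun p : ℝ × ℝ => F p.1 p.2) {p | ε ≤ p.2} :=
  hF.continuousOn.mono fun _ hp => hε.trans_le hp

theorem defect_continuousOn (ha₀ : 0 < a₀) (hε : 0 < ε)
    (hψ : IsComponentSolution a₀ ℓ m ε ψ) :
    ContinuousOn (defect K δ e₁ e₂ ψ) {p | ε ≤ p.2} := by
  have hw : ContinuousOn (fun p : Space × ℝ =>
      ((1 / scaleFactor a₀ ℓ p.2 * p.2 ^ (3 * ℓ / 2) : ℝ) : ℂ)) {p | ε ≤ p.2} :=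
    (weight_continuousOn ha₀ hε).comp continuousOn_snd fun p hp => hp
  have hG : ContinuousOn (fun p : Space × ℝ =>
      ((2 / δ ^ 2 * (deriv cutoff (‖p.1‖ ^ 2 / δ ^ 2) / ‖p.1‖) : ℝ) : ℂ)) {p | ε ≤ p.2} :=
    (Complex.continuous_ofReal.comp (continuous_const.mul
      ((continuous_deriv_cutoff_div δ).comp continuous_fst))).continuousOn
  have hP : ContinuousOn (fun p : Space × ℝ => K.P ‖p.1‖ p.2) {p | ε ≤ p.2} :=
    (kernel_continuousOn K.contDiffOn_P hε).comp (f := fun p : Space × ℝ => (‖p.1‖, p.2))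
      (by fun_prop) fun p hp => hp
  have hQ : ContinuousOn (fun p : Space × ℝ => K.Q ‖p.1‖ p.2) {p | ε ≤ p.2} :=
    (kernel_continuousOn K.contDiffOn_Q hε).comp (f := fun p : Space × ℝ => (‖p.1‖, p.2))
      (by fun_prop) fun p hp => hp
  have hA : ContinuousOn (fun p : Space × ℝ => pauliFst e₁ e₂ p.1) {p | ε ≤ p.2} :=
    ((pauliFst_contDiff e₁ e₂).continuous.comp continuous_fst).continuousOn
  have hB : ContinuousOn (fun p : Space × ℝ => pauliSnd e₁ e₂ p.1) {p | ε ≤ p.2} :=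
    ((pauliSnd_contDiff e₁ e₂).continuous.comp continuous_fst).continuousOn
  have h := hψ.continuousOn
  exact (hw.mul hG).mul ((hQ.mul ((hA.mul (h 0)).add (hB.mul (h 1)))).add
    (hP.mul ((continuousOn_const.mul (h 2)).add (continuousOn_const.mul (h 3)))))

/-- There are no boundary terms: the kernel vanishes at `t₁`, and at time `ε` the kernel or the data
vanish at each point. -/
theorem integral_defect_eq_zero (ha₀ : 0 < a₀) (hε : 0 < ε) (hδ : 0 < δ)
    (hψ : IsComponentSolution a₀ ℓ m ε ψ) {t₁ ρ : ℝ} (ht₁ : ε ≤ t₁)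
    (hρ : ∀ r t, ε ≤ t → ρ < r → K.P r t = 0 ∧ K.Q r t = 0)
    (hend : ∀ r, 0 ≤ r → K.P r t₁ = 0 ∧ K.Q r t₁ = 0)
    (hinit : ∀ y : Space, (K.P ‖y‖ ε = 0 ∧ K.Q ‖y‖ ε = 0) ∨ ∀ i, ψ i (y, ε) = 0) :
    ∫ t in ε..t₁, ∫ y, defect K δ e₁ e₂ ψ (y, t) = 0 := by
  have hz : ∀ p : Space × ℝ, ε ≤ p.2 → ρ < ‖p.1‖ →
      radialTest ℓ δ K.P 3 p = 0 ∧ radialTest ℓ δ K.Q 1 p = 0 := fun p hp hp' => by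
    obtain ⟨h1, h2⟩ := hρ _ _ hp hp'
    simp [radialTest, h1, h2]
  rw [integral_of_conservation_law ht₁ (pairing_continuousOn hε hδ hψ)
    (pairing_contDiffOn hε hδ hψ) (flux_contDiffOn ha₀ hε hδ hψ) (defect_continuousOn ha₀ hε hψ)
    (ρ := ρ) ?_ ?_ ?_ (fun y t ht => conservation_law ha₀ hε hδ hψ y ht)]
  · have h1 : ∀ y : Space, pairing K δ e₁ e₂ ψ (y, t₁) = 0 := fun y => by
      obtain ⟨h1, h2⟩ := hend ‖y‖ (norm_nonneg y)
      simp [pairing, radialTest, h1, h2]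
    have h2 : ∀ y : Space, pairing K δ e₁ e₂ ψ (y, ε) = 0 := fun y => by
      rcases hinit y with ⟨h1, h2⟩ | h
      · simp [pairing, radialTest, h1, h2]
      · simp [pairing, h]
    simp [h1, h2]
  · intro p hp hp'
    obtain ⟨h1, h2⟩ := hz p hp hp'
    simp [pairing, h1, h2]
  · intro k p hp hp'
    obtain ⟨h1, h2⟩ := hz p (le_of_lt hp) hp'
    fin_cases k <;> simp [flux, h1, h2]
  · intro p hp hp'
    obtain ⟨h1, h2⟩ := hρ _ _ hp hp'
    simp [defect, h1, h2]

variable (K e₁ e₂ ψ) in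
/-- The defect after the substitution `y = δ z`. -/
def scaledDefect (δ : ℝ) (z : Space) (t : ℝ) : ℂ :=
  ((1 / scaleFactor a₀ ℓ t * t ^ (3 * ℓ / 2) : ℝ) : ℂ) *
    ((2 * (deriv cutoff (‖z‖ ^ 2 / 1 ^ 2) / ‖z‖) : ℝ) : ℂ) *
    (δ * K.Q (δ * ‖z‖) t * (pauliFst e₁ e₂ z * ψ 0 (δ • z, t) + pauliSnd e₁ e₂ z * ψ 1 (δ • z, t))
      + K.P (δ * ‖z‖) t * (e₁ * ψ 2 (δ • z, t) + e₂ * ψ 3 (δ • z, t)))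

/-- The Jacobian `δ³` cancels the factor `δ⁻² ‖y‖⁻¹ = δ⁻³ ‖z‖⁻¹` exactly. The `Q` term keeps a
factor `δ` from the linear Pauli forms, so the rescaled expression extends continuously to `δ = 0`.
-/
theorem integral_defect_eq_scaled (hδ : 0 < δ) (t : ℝ) :
    ∫ y, defect K δ e₁ e₂ ψ (y, t) = ∫ z, scaledDefect K e₁ e₂ ψ δ z t := by
  have h := MeasureTheory.Measure.integral_comp_smul (MeasureTheory.volume : MeasureTheory.Measure Space)
    (fun y => defect K δ e₁ e₂ ψ (y, t)) δ
  rw [finrank_euclideanSpace_fin, abs_of_pos (by positivity), eq_comm,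
    inv_smul_eq_iff₀ (by positivity)] at h
  rw [h, ← MeasureTheory.integral_smul]
  congr 1
  ext z
  have hn : ‖δ • z‖ = δ * ‖z‖ := by rw [norm_smul, Real.norm_of_nonneg hδ.le]
  have hA : pauliFst e₁ e₂ (δ • z) = δ * pauliFst e₁ e₂ z := by simp [pauliFst]; ring
  have hB : pauliSnd e₁ e₂ (δ • z) = δ * pauliSnd e₁ e₂ z := by simp [pauliSnd]; ring
  have hq : (δ * ‖z‖) ^ 2 / δ ^ 2 = ‖z‖ ^ 2 / 1 ^ 2 := by field_simp
  have hδc : (δ : ℂ) ≠ 0 := by exact_mod_cast hδ.ne'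
  simp only [scaledDefect, defect, hn, hA, hB, hq, Complex.real_smul]
  push_cast
  rcases eq_or_ne z 0 with rfl | hz
  · simp
  have hz0 : (‖z‖ : ℂ) ≠ 0 := by exact_mod_cast norm_ne_zero_iff.2 hz
  field_simp

theorem continuous_integral_scaledDefect (ha₀ : 0 < a₀) (hε : 0 < ε)
    (hψ : IsComponentSolution a₀ ℓ m ε ψ) :
    -- Clamping the time to `[ε, ∞)` gives a function continuous on the whole plane without changing
    -- it on the range of integration.
    Continuous fun p : ℝ × ℝ => ∫ z, scaledDefect K e₁ e₂ ψ p.1 z (max ε p.2) := by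
  rw [← continuousOn_univ]
  refine continuousOn_integral_of_compact_support
    (f := fun (p : ℝ × ℝ) z => scaledDefect K e₁ e₂ ψ p.1 z (max ε p.2))
    (isCompact_closedBall (0 : Space) 2) (Continuous.continuousOn ?_) fun p z _ hz => ?_
  · have hw : Continuous fun p : (ℝ × ℝ) × Space =>
        ((1 / scaleFactor a₀ ℓ (max ε p.1.2) * (max ε p.1.2) ^ (3 * ℓ / 2) : ℝ) : ℂ) :=
      (weight_continuousOn ha₀ hε).comp_continuous (f := fun p : (ℝ × ℝ) × Space => max ε p.1.2)
        (by fun_prop) fun p => Set.mem_Ici.2 (le_max_left _ _)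
    have hG : Continuous fun p : (ℝ × ℝ) × Space =>
        ((2 * (deriv cutoff (‖p.2‖ ^ 2 / 1 ^ 2) / ‖p.2‖) : ℝ) : ℂ) :=
      Complex.continuous_ofReal.comp (continuous_const.mul
        ((continuous_deriv_cutoff_div 1).comp continuous_snd))
    have hP : Continuous fun p : (ℝ × ℝ) × Space => K.P (p.1.1 * ‖p.2‖) (max ε p.1.2) :=
      (kernel_continuousOn K.contDiffOn_P hε).comp_continuous
        (f := fun p : (ℝ × ℝ) × Space => (p.1.1 * ‖p.2‖, max ε p.1.2)) (by fun_prop)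
        fun p => le_max_left ε p.1.2
    have hQ : Continuous fun p : (ℝ × ℝ) × Space => K.Q (p.1.1 * ‖p.2‖) (max ε p.1.2) :=
      (kernel_continuousOn K.contDiffOn_Q hε).comp_continuous
        (f := fun p : (ℝ × ℝ) × Space => (p.1.1 * ‖p.2‖, max ε p.1.2)) (by fun_prop)
        fun p => le_max_left ε p.1.2
    have hA : Continuous fun p : (ℝ × ℝ) × Space => pauliFst e₁ e₂ p.2 :=
      (pauliFst_contDiff e₁ e₂).continuous.comp continuous_snd
    have hB : Continuous fun p : (ℝ × ℝ) × Space => pauliSnd e₁ e₂ p.2 :=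
      (pauliSnd_contDiff e₁ e₂).continuous.comp continuous_snd
    have h (i) : Continuous fun p : (ℝ × ℝ) × Space => ψ i (p.1.1 • p.2, max ε p.1.2) :=
      (hψ.continuousOn i).comp_continuous
        (f := fun p : (ℝ × ℝ) × Space => (p.1.1 • p.2, max ε p.1.2)) (by fun_prop)
        fun p => le_max_left ε p.1.2
    have hd : Continuous fun p : (ℝ × ℝ) × Space => (p.1.1 : ℂ) := by fun_prop
    exact (hw.mul hG).mul (((hd.mul hQ).mul ((hA.mul (h 0)).add (hB.mul (h 1)))).add
      (hP.mul ((continuous_const.mul (h 2)).add (continuous_const.mul (h 3)))))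
  · have hz2 : 2 < ‖z‖ := by simpa using hz
    have : deriv cutoff (‖z‖ ^ 2 / 1 ^ 2) = 0 := deriv_cutoff_of_ge (by nlinarith)
    simp only [scaledDefect, this]
    simp

/-- The rescaled integral is zero for every `δ > 0`, hence at `δ = 0` by continuity. There the `Q`
term is gone and the remaining values no longer depend on `z`, so the positive constant
`integral_deriv_cutoff_pos` factors out. -/
theorem integral_kernel_vertex_eq_zero (ha₀ : 0 < a₀) (hε : 0 < ε)
    (hψ : IsComponentSolution a₀ ℓ m ε ψ) {t₁ ρ : ℝ} (ht₁ : ε ≤ t₁)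
    (hρ : ∀ r t, ε ≤ t → ρ < r → K.P r t = 0 ∧ K.Q r t = 0)
    (hend : ∀ r, 0 ≤ r → K.P r t₁ = 0 ∧ K.Q r t₁ = 0)
    (hinit : ∀ y : Space, (K.P ‖y‖ ε = 0 ∧ K.Q ‖y‖ ε = 0) ∨ ∀ i, ψ i (y, ε) = 0) :
    ∫ t in ε..t₁, ((1 / scaleFactor a₀ ℓ t * t ^ (3 * ℓ / 2) : ℝ) : ℂ) *
      (K.P 0 t * (e₁ * ψ 2 (0, t) + e₂ * ψ 3 (0, t))) = 0 := by
  set f : ℝ → ℂ := fun δ => ∫ t in ε..t₁, ∫ z, scaledDefect K e₁ e₂ ψ δ z (max ε t) with hf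
  have hcont : Continuous f :=
    intervalIntegral.continuous_parametric_intervalIntegral_of_continuous'
      (continuous_integral_scaledDefect (K := K) (e₁ := e₁) (e₂ := e₂) ha₀ hε hψ) ε t₁
  have hmax : ∀ δ, f δ = ∫ t in ε..t₁, ∫ z, scaledDefect K e₁ e₂ ψ δ z t := fun δ =>
    intervalIntegral.integral_congr fun t ht => by
      rw [Set.uIcc_of_le ht₁] at ht
      simp only [max_eq_right ht.1]
  have hpos : ∀ δ, 0 < δ → f δ = 0 := fun δ hδ => by
    rw [hmax, ← integral_defect_eq_zero (K := K) (e₁ := e₁) (e₂ := e₂) ha₀ hε hδ hψ ht₁ hρ hend hinit]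
    exact intervalIntegral.integral_congr fun t _ => (integral_defect_eq_scaled hδ t).symm
  have h0 : f 0 = 0 := by
    refine tendsto_nhds_unique (hcont.continuousAt.continuousWithinAt (s := Set.Ioi 0)) ?_
    refine (tendsto_const_nhds (x := (0 : ℂ))).congr' ?_
    filter_upwards [self_mem_nhdsWithin] with δ hδ using (hpos δ hδ).symm
  rw [hmax] at h0
  have hc : ((∫ z : Space, 2 * (deriv cutoff (‖z‖ ^ 2 / 1 ^ 2) / ‖z‖) : ℝ) : ℂ) ≠ 0 := by
    exact_mod_cast integral_deriv_cutoff_pos.ne'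
  have heq : ∀ t, ∫ z, scaledDefect K e₁ e₂ ψ 0 z t =
      ((∫ z : Space, 2 * (deriv cutoff (‖z‖ ^ 2 / 1 ^ 2) / ‖z‖) : ℝ) : ℂ) *
      (((1 / scaleFactor a₀ ℓ t * t ^ (3 * ℓ / 2) : ℝ) : ℂ) *
      (K.P 0 t * (e₁ * ψ 2 (0, t) + e₂ * ψ 3 (0, t)))) := fun t => by
    rw [← integral_complex_ofReal, ← MeasureTheory.integral_mul_const]
    congr 1
    ext z
    simp only [scaledDefect]
    simp
    ring
  simp only [heq] at h0
  rw [intervalIntegral.integral_const_mul] at h0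
  exact (mul_eq_zero.1 h0).resolve_left hc

end Limit

/-! ### Explicit radial kernels -/

/-- The conformal time. -/
def conformalTime (a₀ ℓ t : ℝ) : ℝ := phi ℓ t / a₀

theorem conformalTime_hasDerivAt {a₀ ℓ : ℝ} (hℓ : ℓ ≠ 1) {t : ℝ} (ht : 0 < t) :
    HasDerivAt (conformalTime a₀ ℓ) (1 / scaleFactor a₀ ℓ t) t := by
  have h := (phi_hasDerivAt hℓ ht).div_const a₀
  rw [Real.rpow_neg ht.le, show (t ^ ℓ)⁻¹ / a₀ = 1 / scaleFactor a₀ ℓ t by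
    rw [scaleFactor, one_div, mul_inv]; ring] at h
  exact h

theorem conformalTime_ne_zero {a₀ ℓ : ℝ} (ha₀ : 0 < a₀) (hℓ : ℓ ≠ 1) {t : ℝ} (ht : 0 < t) :
    conformalTime a₀ ℓ t ≠ 0 := div_ne_zero (phi_ne_zero hℓ ht) ha₀.ne'

theorem conformalTime_strictMonoOn {a₀ ℓ : ℝ} (ha₀ : 0 < a₀) (hℓ : ℓ ≠ 1) :
    StrictMonoOn (conformalTime a₀ ℓ) (Set.Ioi 0) := fun _ hs _ ht hst =>
  div_lt_div_of_pos_right (phi_strictMonoOn hℓ hs ht hst) ha₀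

theorem conformalTime_contDiffAt {a₀ ℓ : ℝ} {t : ℝ} (ht : 0 < t) :
    ContDiffAt ℝ 1 (conformalTime a₀ ℓ) t :=
  ((contDiffAt_id.rpow_const_of_ne ht.ne').div_const _).div_const _

/-- This turns the mass term `i m / t` into `M / (a τ)`, that is, into `M / τ` in conformal time. -/
theorem scaleFactor_mul_conformalTime {a₀ ℓ : ℝ} (ha₀ : 0 < a₀) (hℓ : ℓ ≠ 1) {t : ℝ}
    (ht : 0 < t) : scaleFactor a₀ ℓ t * conformalTime a₀ ℓ t * (1 - ℓ) = t := by
  have hl : 1 - ℓ ≠ 0 := sub_ne_zero.2 hℓ.symm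
  have : t ^ ℓ * t ^ (1 - ℓ) = t := by rw [← Real.rpow_add ht]; simp
  rw [scaleFactor, conformalTime, phi]
  field_simp
  exact this

/-- A radial kernel from a solution of the radial equations in conformal time. -/
def RadialKernel.ofConformal {a₀ ℓ : ℝ} (ha₀ : 0 < a₀) (hℓ : ℓ ≠ 1) {m M : ℂ}
    (hM : I * m = M * (1 - ℓ)) (p q pr pτ qr qτ : ℝ → ℝ → ℂ)
    (hp : ∀ r τ, τ ≠ 0 → ContDiffAt ℝ 1 (fun z : ℝ × ℝ => p z.1 z.2) (r, τ))
    (hq : ∀ r τ, τ ≠ 0 → ContDiffAt ℝ 1 (fun z : ℝ × ℝ => q z.1 z.2) (r, τ))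
    (hpr : ∀ r τ, τ ≠ 0 → HasDerivAt (fun s => p s τ) (pr r τ) r)
    (hpτ : ∀ r τ, τ ≠ 0 → HasDerivAt (fun s => p r s) (pτ r τ) τ)
    (hqr : ∀ r τ, τ ≠ 0 → HasDerivAt (fun s => q s τ) (qr r τ) r)
    (hqτ : ∀ r τ, τ ≠ 0 → HasDerivAt (fun s => q r s) (qτ r τ) τ)
    (h₁ : ∀ r τ : ℝ, τ ≠ 0 → pτ r τ = M / τ * p r τ - (r * qr r τ - q r τ))
    (h₂ : ∀ r τ : ℝ, τ ≠ 0 → r * qτ r τ = -(M / τ) * (r * q r τ) - pr r τ) :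
    RadialKernel a₀ ℓ m where
  P r t := p r (conformalTime a₀ ℓ t)
  Q r t := q r (conformalTime a₀ ℓ t)
  contDiffOn_P z hz := by
    apply ContDiffAt.contDiffWithinAt
    exact ContDiffAt.comp (g := fun z : ℝ × ℝ => p z.1 z.2)
      (f := fun z : ℝ × ℝ => (z.1, conformalTime a₀ ℓ z.2)) z
      (hp _ _ (conformalTime_ne_zero ha₀ hℓ hz))
      (contDiffAt_fst.prodMk ((conformalTime_contDiffAt hz).comp z contDiffAt_snd))
  contDiffOn_Q z hz := by
    apply ContDiffAt.contDiffWithinAt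
    exact ContDiffAt.comp (g := fun z : ℝ × ℝ => q z.1 z.2)
      (f := fun z : ℝ × ℝ => (z.1, conformalTime a₀ ℓ z.2)) z
      (hq _ _ (conformalTime_ne_zero ha₀ hℓ hz))
      (contDiffAt_fst.prodMk ((conformalTime_contDiffAt hz).comp z contDiffAt_snd))
  deriv_P r t ht := by
    have h0 := conformalTime_ne_zero ha₀ hℓ ht
    have hd := (hpτ r _ h0).scomp t (conformalTime_hasDerivAt hℓ ht)
    have hs : (scaleFactor a₀ ℓ t : ℂ) * conformalTime a₀ ℓ t * (1 - ℓ) = t := by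
      exact_mod_cast scaleFactor_mul_conformalTime ha₀ hℓ ht
    have ha : (scaleFactor a₀ ℓ t : ℂ) ≠ 0 := by exact_mod_cast (scaleFactor_pos ha₀ ℓ ht).ne'
    have h0c : (conformalTime a₀ ℓ t : ℂ) ≠ 0 := by exact_mod_cast h0
    have hlc : (1 - ℓ : ℂ) ≠ 0 := sub_ne_zero.2 (by exact_mod_cast hℓ.symm)
    refine hd.deriv.trans ?_
    rw [(hqr r _ h0).deriv, h₁ r _ h0, hM, ← hs, Complex.real_smul]
    push_cast
    field_simp
  deriv_Q r t ht := by
    have h0 := conformalTime_ne_zero ha₀ hℓ ht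
    have hd := (hqτ r _ h0).scomp t (conformalTime_hasDerivAt hℓ ht)
    have hs : (scaleFactor a₀ ℓ t : ℂ) * conformalTime a₀ ℓ t * (1 - ℓ) = t := by
      exact_mod_cast scaleFactor_mul_conformalTime ha₀ hℓ ht
    have ha : (scaleFactor a₀ ℓ t : ℂ) ≠ 0 := by exact_mod_cast (scaleFactor_pos ha₀ ℓ ht).ne'
    have h0c : (conformalTime a₀ ℓ t : ℂ) ≠ 0 := by exact_mod_cast h0
    have hlc : (1 - ℓ : ℂ) ≠ 0 := sub_ne_zero.2 (by exact_mod_cast hℓ.symm)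
    have e := h₂ r _ h0
    refine (congrArg (fun z => (r : ℂ) * z) hd.deriv).trans ?_
    rw [(hpr r _ h0).deriv, hM, ← hs, Complex.real_smul]
    push_cast
    calc (r : ℂ) * (1 / (scaleFactor a₀ ℓ t : ℂ) * qτ r (conformalTime a₀ ℓ t))
        = 1 / (scaleFactor a₀ ℓ t : ℂ) * (r * qτ r (conformalTime a₀ ℓ t)) := by ring
      _ = _ := by rw [e]; field_simp

/-- For `M ∈ {0, 1, -1}` there are radial kernels concentrated near a light cone, with an
arbitrary smooth profile `b`. -/
theorem exists_radialKernel {a₀ ℓ : ℝ} (ha₀ : 0 < a₀) (hℓ : ℓ ≠ 1) {m M : ℂ}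
    (hM : I * m = M * (1 - ℓ)) (hM' : M = 0 ∨ M = 1 ∨ M = -1) {b : ℝ → ℝ} (hb : ContDiff ℝ 3 b) :
    ∃ (K : RadialKernel a₀ ℓ m),
      (∀ t, 0 < t → K.P 0 t = (if M = -1 then (conformalTime a₀ ℓ t : ℂ) else -1) *
        b (conformalTime a₀ ℓ t)) ∧
      ∀ r t, b (conformalTime a₀ ℓ t + r) = 0 → deriv b (conformalTime a₀ ℓ t + r) = 0 →
        K.P r t = 0 ∧ K.Q r t = 0 := by
  have hb1 : ContDiff ℝ 2 (deriv b) := hb.deriv'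
  have hd0 : ∀ s, HasDerivAt b (deriv b s) s := fun s =>
    (hb.differentiable (by norm_num) s).hasDerivAt
  have hd1 : ∀ s, HasDerivAt (deriv b) (deriv (deriv b) s) s := fun s =>
    (hb1.differentiable (by norm_num) s).hasDerivAt
  generalize deriv (deriv b) = b₂ at hd1
  generalize deriv b = b₁ at hb1 hd0 hd1
  have hB0 : ContDiff ℝ 1 fun s => (b s : ℂ) :=
    Complex.ofRealCLM.contDiff.comp (hb.of_le (by norm_num))
  have hB1 : ContDiff ℝ 1 fun s => (b₁ s : ℂ) :=
    Complex.ofRealCLM.contDiff.comp (hb1.of_le one_le_two)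
  have d0 : ∀ s, HasDerivAt (fun s => (b s : ℂ)) (b₁ s : ℂ) s := fun s =>
    (hd0 s).ofReal_comp
  have d1 : ∀ s, HasDerivAt (fun s => (b₁ s : ℂ)) (b₂ s : ℂ) s := fun s =>
    (hd1 s).ofReal_comp
  have c0 : ContDiff ℝ 1 fun z : ℝ × ℝ => (b (z.2 + z.1) : ℂ) :=
    hB0.comp (contDiff_snd.add contDiff_fst)
  have c1 : ContDiff ℝ 1 fun z : ℝ × ℝ => (b₁ (z.2 + z.1) : ℂ) :=
    hB1.comp (contDiff_snd.add contDiff_fst)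
  have cr : ContDiff ℝ 1 fun z : ℝ × ℝ => (z.1 : ℂ) := Complex.ofRealCLM.contDiff.comp contDiff_fst
  have cτ : ContDiff ℝ 1 fun z : ℝ × ℝ => (z.2 : ℂ) := Complex.ofRealCLM.contDiff.comp contDiff_snd
  have cinv : ∀ r τ : ℝ, τ ≠ 0 → ContDiffAt ℝ 1 (fun z : ℝ × ℝ => (z.2 : ℂ)⁻¹) (r, τ) :=
    fun r τ h => cτ.contDiffAt.inv (by exact_mod_cast h)
  have d0r : ∀ r τ : ℝ, HasDerivAt (fun s : ℝ => (b (τ + s) : ℂ)) (b₁ (τ + r) : ℂ) r :=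
    fun r τ => (d0 (τ + r)).comp_const_add τ r
  have d0τ : ∀ r τ : ℝ, HasDerivAt (fun s : ℝ => (b (s + r) : ℂ)) (b₁ (τ + r) : ℂ) τ :=
    fun r τ => (d0 (τ + r)).comp_add_const τ r
  have d1r : ∀ r τ : ℝ, HasDerivAt (fun s : ℝ => (b₁ (τ + s) : ℂ))
      (b₂ (τ + r) : ℂ) r := fun r τ => (d1 (τ + r)).comp_const_add τ r
  have d1τ : ∀ r τ : ℝ, HasDerivAt (fun s : ℝ => (b₁ (s + r) : ℂ))
      (b₂ (τ + r) : ℂ) τ := fun r τ => (d1 (τ + r)).comp_add_const τ r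
  have did : ∀ s : ℝ, HasDerivAt (fun s : ℝ => (s : ℂ)) 1 s := fun s =>
    (hasDerivAt_id s).ofReal_comp
  have dinv : ∀ τ : ℝ, τ ≠ 0 → HasDerivAt (fun s : ℝ => (s : ℂ)⁻¹) (-(1 : ℂ) / (τ : ℂ) ^ 2) τ :=
    fun τ h => (did τ).inv (by exact_mod_cast h)
  by_cases h : M = -1
  -- Here `Q / r` is a free spherical wave. Writing `Q = G''(τ + r)` and integrating the second
  -- relation gives `P = (r G' - G) / τ - r G'' + G'`. The choice `G(s) = s B(s)` with `B' = b`
  -- makes the antiderivative `B` cancel, so that only `b` and `b'` remain, and gives `P(0, τ) = τ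
  -- b(τ)`.
  · refine ⟨RadialKernel.ofConformal ha₀ hℓ hM
      (fun r τ => -(r * (b (τ + r) + (τ + r) * b₁ (τ + r))) + (τ + r) * b (τ + r)
        + r ^ 2 * (τ : ℂ)⁻¹ * b (τ + r))
      (fun r τ => (τ + r) * b₁ (τ + r) + 2 * b (τ + r))
      (fun r τ => -(r * (2 * b₁ (τ + r) + (τ + r) * b₂ (τ + r)))
        - (b (τ + r) + (τ + r) * b₁ (τ + r)) + (τ + r) * b₁ (τ + r) + b (τ + r)
        + 2 * r * (τ : ℂ)⁻¹ * b (τ + r) + r ^ 2 * (τ : ℂ)⁻¹ * b₁ (τ + r))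
      (fun r τ => -(r * (2 * b₁ (τ + r) + (τ + r) * b₂ (τ + r)))
        + (τ + r) * b₁ (τ + r) + b (τ + r)
        + r ^ 2 * (τ : ℂ)⁻¹ * b₁ (τ + r) - r ^ 2 / τ ^ 2 * b (τ + r))
      (fun r τ => (τ + r) * b₂ (τ + r) + 3 * b₁ (τ + r))
      (fun r τ => (τ + r) * b₂ (τ + r) + 3 * b₁ (τ + r))
      ?_ ?_ ?_ ?_ ?_ ?_ ?_ ?_, ?_, ?_⟩
    · intro r τ h0
      exact (((cr.mul (c0.add ((cτ.add cr).mul c1))).neg.add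
        ((cτ.add cr).mul c0)).contDiffAt).add (((cr.pow 2).contDiffAt.mul (cinv r τ h0)).mul
          c0.contDiffAt)
    · intro r τ h0
      exact (((cτ.add cr).mul c1).add (contDiff_const.mul c0)).contDiffAt
    · intro r τ h0
      have ds : HasDerivAt (fun s : ℝ => (τ : ℂ) + s) 1 r := (did r).const_add _
      convert! ((((did r).mul ((d0r r τ).add (ds.mul (d1r r τ)))).neg.add (ds.mul (d0r r τ))).add
        ((((did r).pow 2).mul_const (τ : ℂ)⁻¹).mul (d0r r τ))) using 1
      simp; ring
    · intro r τ h0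
      have ds : HasDerivAt (fun s : ℝ => (s : ℂ) + r) 1 τ := (did τ).add_const _
      convert! (((((d0τ r τ).add (ds.mul (d1τ r τ))).const_mul (r : ℂ)).neg.add
        (ds.mul (d0τ r τ))).add
        (((dinv τ h0).const_mul ((r : ℂ) ^ 2)).mul (d0τ r τ))) using 1
      simp; ring
    · intro r τ h0
      have ds : HasDerivAt (fun s : ℝ => (τ : ℂ) + s) 1 r := (did r).const_add _
      convert! ((ds.mul (d1r r τ)).add ((d0r r τ).const_mul 2)) using 1
      simp; ring
    · intro r τ h0
      have ds : HasDerivAt (fun s : ℝ => (s : ℂ) + r) 1 τ := (did τ).add_const _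
      convert! ((ds.mul (d1τ r τ)).add ((d0τ r τ).const_mul 2)) using 1
      simp; ring
    · intro r τ h0
      have h0c : (τ : ℂ) ≠ 0 := by exact_mod_cast h0
      rw [h]; field_simp; ring
    · intro r τ h0
      have h0c : (τ : ℂ) ≠ 0 := by exact_mod_cast h0
      rw [h]; field_simp; ring
    · intro t ht
      simp [RadialKernel.ofConformal, h]
    · intro r t hb0 hb0'
      simp [RadialKernel.ofConformal, hb0, hb0']
  · have hM2 : M * M = M := by
      rcases hM' with h' | h' | h'
      · simp [h']
      · simp [h']
      · exact absurd h' h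
    -- Here `P / r²` is the radial derivative of the free spherical wave `b(τ + r) / r`, and `Q / r
    -- = -(∂_τ - M / τ)(b / r)`. The second radial equation holds precisely because `M² = M`.
    refine ⟨RadialKernel.ofConformal ha₀ hℓ hM
      (fun r τ => r * b₁ (τ + r) - b (τ + r))
      (fun r τ => -b₁ (τ + r) + M * (τ : ℂ)⁻¹ * b (τ + r))
      (fun r τ => r * b₂ (τ + r))
      (fun r τ => r * b₂ (τ + r) - b₁ (τ + r))
      (fun r τ => -b₂ (τ + r) + M * (τ : ℂ)⁻¹ * b₁ (τ + r))
      (fun r τ => -b₂ (τ + r) + M * (τ : ℂ)⁻¹ * b₁ (τ + r)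
        - M / τ ^ 2 * b (τ + r))
      ?_ ?_ ?_ ?_ ?_ ?_ ?_ ?_, ?_, ?_⟩
    · intro r τ h0
      exact ((cr.mul c1).sub c0).contDiffAt
    · intro r τ h0
      exact c1.neg.contDiffAt.add ((contDiffAt_const.mul (cinv r τ h0)).mul c0.contDiffAt)
    · intro r τ h0
      convert! ((did r).mul (d1r r τ)).sub (d0r r τ) using 1
      simp
    · intro r τ h0
      exact ((d1τ r τ).const_mul (r : ℂ)).sub (d0τ r τ)
    · intro r τ h0
      exact (d1r r τ).neg.add ((d0r r τ).const_mul _)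
    · intro r τ h0
      convert! (d1τ r τ).neg.add (((dinv τ h0).const_mul M).mul (d0τ r τ)) using 1
      ring
    · intro r τ h0
      ring
    · intro r τ h0
      have h0c : (τ : ℂ) ≠ 0 := by exact_mod_cast h0
      field_simp
      linear_combination (r : ℂ) * b (τ + r) * hM2
    · intro t ht
      simp [RadialKernel.ofConformal, h]
    · intro r t hb0 hb0'
      simp [RadialKernel.ofConformal, hb0, hb0']

/-! ### Huygens' principle -/

/-- The integral identity at the vertex holds for bumps `b` concentrated at `τ(t₀)`, and the factor
of `b` in `P(0, t)` never vanishes; the fundamental lemma of the calculus of variations then gives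
the value at `t₀`. -/
theorem lower_combination_eq_zero {a₀ ℓ : ℝ} (ha₀ : 0 < a₀) (hℓ : ℓ ≠ 1) {m M : ℂ}
    (hM : I * m = M * (1 - ℓ)) (hM' : M = 0 ∨ M = 1 ∨ M = -1) {ε : ℝ} (hε : 0 < ε)
    {ψ : Fin 4 → Space × ℝ → ℂ} (hψ : IsComponentSolution a₀ ℓ m ε ψ) {t₀ : ℝ} (ht₀ : ε < t₀)
    {κ₀ : ℝ} (hκ₀ : 0 < κ₀)
    (hinit : ∀ y : Space,
      |conformalTime a₀ ℓ ε + ‖y‖ - conformalTime a₀ ℓ t₀| ≤ κ₀ → ∀ i, ψ i (y, ε) = 0)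
    (e₁ e₂ : ℂ) : e₁ * ψ 2 (0, t₀) + e₂ * ψ 3 (0, t₀) = 0 := by
  have ht₀0 : 0 < t₀ := hε.trans ht₀
  set τ := conformalTime a₀ ℓ with hτ
  have hmono : StrictMonoOn τ (Set.Ioi 0) := conformalTime_strictMonoOn ha₀ hℓ
  have hτc : ContinuousOn τ (Set.Ici ε) := fun t ht =>
    (conformalTime_hasDerivAt hℓ (hε.trans_le ht)).continuousAt.continuousWithinAt
  set g : ℝ → ℂ := fun t => ((1 / scaleFactor a₀ ℓ t * t ^ (3 * ℓ / 2) : ℝ) : ℂ) *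
    ((if M = -1 then (τ t : ℂ) else -1) * (e₁ * ψ 2 (0, t) + e₂ * ψ 3 (0, t))) with hg
  have hgc : ContinuousOn g (Set.Ici ε) := by
    have h (i) : ContinuousOn (fun t => ψ i ((0 : Space), t)) (Set.Ici ε) :=
      (hψ.continuousOn i).comp (by fun_prop) fun t ht => ht
    refine (weight_continuousOn ha₀ hε).mul (ContinuousOn.mul ?_
      ((continuousOn_const.mul (h 2)).add (continuousOn_const.mul (h 3))))
    split_ifs
    · exact Complex.continuous_ofReal.comp_continuousOn hτc
    · exact continuousOn_const
  by_contra hne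
  have hg0 : g t₀ ≠ 0 := by
    refine mul_ne_zero ?_ (mul_ne_zero ?_ hne)
    · have h1 := scaleFactor_pos ha₀ ℓ ht₀0
      have h2 := Real.rpow_pos_of_pos ht₀0 (3 * ℓ / 2)
      exact_mod_cast (mul_pos (one_div_pos.2 h1) h2).ne'
    · split_ifs
      · exact_mod_cast conformalTime_ne_zero ha₀ hℓ ht₀0
      · exact neg_ne_zero.2 one_ne_zero
  -- Multiplying by the conjugate of `g t₀` and taking real parts gives a real integrand that is
  -- positive near `t₀`.
  set f : ℝ → ℝ := fun t => (starRingEnd ℂ (g t₀) * g t).re with hf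
  have hfc : ContinuousOn f (Set.Ici ε) :=
    Complex.continuous_re.comp_continuousOn (continuousOn_const.mul hgc)
  have hf0 : 0 < f t₀ := by
    simp only [hf]
    rw [mul_comm, Complex.mul_conj, Complex.ofReal_re]
    exact Complex.normSq_pos.2 hg0
  obtain ⟨η, hη, hfη⟩ : ∃ η > 0, ∀ t, |t - t₀| < η → 0 < f t ∧ ε < t := by
    have h1 : ∀ᶠ t in nhds t₀, 0 < f t :=
      (hfc.continuousAt (Ici_mem_nhds ht₀)).eventually (lt_mem_nhds hf0)
    have h2 : ∀ᶠ t in nhds t₀, ε < t := Ioi_mem_nhds ht₀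
    obtain ⟨η, hη, h⟩ := Metric.eventually_nhds_iff.1 (h1.and h2)
    exact ⟨η, hη, fun t ht => h (by rwa [Real.dist_eq])⟩
  have hlo : ε < t₀ - η / 2 := (hfη (t₀ - η / 2) (by
    rw [show t₀ - η / 2 - t₀ = -(η / 2) by ring, abs_neg, abs_of_pos] <;> linarith)).2
  set t₁ := t₀ + η / 2 with ht₁
  have hlt1 : τ t₀ < τ t₁ := hmono ht₀0 (show 0 < t₁ by linarith) (by linarith)
  have hlt2 : τ (t₀ - η / 2) < τ t₀ := hmono (show 0 < t₀ - η / 2 by linarith) ht₀0 (by linarith)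
  -- The first two bounds keep the bump, read in the time `t`, inside the interval where `f > 0` and
  -- make the kernel vanish at `t₁`; the third puts its trace at time `ε` inside the shell free of
  -- data.
  obtain ⟨κ, hκ, hκ1, hκ2, hκ3⟩ : ∃ κ > 0, κ < τ t₁ - τ t₀ ∧ κ < τ t₀ - τ (t₀ - η / 2) ∧ κ < κ₀ := by
    obtain ⟨κ, h1, h2⟩ := exists_between (lt_min (lt_min (sub_pos.2 hlt1) (sub_pos.2 hlt2)) hκ₀)
    simp only [lt_min_iff] at h2
    exact ⟨κ, h1, h2.1.1, h2.1.2, h2.2⟩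
  let bump : ContDiffBump (τ t₀) := ⟨κ / 2, κ, by linarith, by linarith⟩
  have hbz : ∀ s, κ < |s - τ t₀| → bump s = 0 := fun s hs =>
    bump.zero_of_le_dist (by rw [Real.dist_eq]; exact hs.le)
  have hbd : ∀ s, κ < |s - τ t₀| → deriv bump s = 0 := fun s hs => by
    have : (bump : ℝ → ℝ) =ᶠ[nhds s] fun _ => 0 := by
      have hc : ContinuousAt (fun u : ℝ => |u - τ t₀|) s := by fun_prop
      filter_upwards [hc.eventually (lt_mem_nhds hs)] with u hu using hbz u hu
    rw [this.deriv_eq, deriv_const]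
  obtain ⟨K, hK0, hKz⟩ := exists_radialKernel (a₀ := a₀) ha₀ hℓ hM hM' (b := bump) bump.contDiff
  have hKz' : ∀ r t, κ < |τ t + r - τ t₀| → K.P r t = 0 ∧ K.Q r t = 0 := fun r t h =>
    hKz r t (hbz _ h) (hbd _ h)
  have hint := integral_kernel_vertex_eq_zero (K := K) (e₁ := e₁) (e₂ := e₂) ha₀ hε hψ
    (t₁ := t₁) (ρ := κ + τ t₀ - τ ε) (by linarith) ?_ ?_ ?_
  · have hcong : ∀ t ∈ Set.uIcc ε t₁, ((1 / scaleFactor a₀ ℓ t * t ^ (3 * ℓ / 2) : ℝ) : ℂ) *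
        (K.P 0 t * (e₁ * ψ 2 (0, t) + e₂ * ψ 3 (0, t))) = (bump (τ t) : ℂ) * g t := fun t ht => by
      rw [Set.uIcc_of_le (by linarith)] at ht
      rw [hK0 t (hε.trans_le ht.1)]
      simp only [hg]; ring
    rw [intervalIntegral.integral_congr hcong] at hint
    have hbc : ContinuousOn (fun t => bump (τ t)) (Set.Ici ε) :=
      bump.continuous.comp_continuousOn hτc
    have hIcc : Set.Icc ε t₁ ⊆ Set.Ici ε := Set.Icc_subset_Ici_self
    have hre : ∫ t in ε..t₁, bump (τ t) * f t = 0 := by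
      have hi : IntervalIntegrable (fun t => starRingEnd ℂ (g t₀) * ((bump (τ t) : ℂ) * g t))
          MeasureTheory.volume ε t₁ := by
        refine ContinuousOn.intervalIntegrable ?_
        rw [Set.uIcc_of_le (by linarith)]
        exact (continuousOn_const.mul
          ((Complex.continuous_ofReal.comp_continuousOn hbc).mul hgc)).mono hIcc
      have h := Complex.reCLM.intervalIntegral_comp_comm hi
      rw [intervalIntegral.integral_const_mul, hint, mul_zero, map_zero] at h
      rw [← h]
      refine intervalIntegral.integral_congr fun t _ => ?_
      simp only [hf, Complex.reCLM_apply]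
      rw [show starRingEnd ℂ (g t₀) * ((bump (τ t) : ℂ) * g t) =
        (bump (τ t) : ℂ) * (starRingEnd ℂ (g t₀) * g t) by ring, Complex.re_ofReal_mul]
    refine (intervalIntegral.integral_pos (show ε < t₁ by linarith)
      ((hbc.mul hfc).mono hIcc) (fun t ht => ?_) ⟨t₀, ⟨ht₀.le, by linarith⟩, ?_⟩).ne' hre
    · by_cases hc : κ < |τ t - τ t₀|
      · exact (mul_eq_zero_of_left (hbz _ hc) (f t)).ge
      · rw [not_lt, abs_le] at hc
        have ht0 : 0 < t := hε.trans ht.1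
        have h1 : t₀ - η / 2 < t := (hmono.lt_iff_lt (show 0 < t₀ - η / 2 by linarith) ht0).1
          (by linarith [hc.1])
        have h2 : t < t₁ := (hmono.lt_iff_lt ht0 (show 0 < t₁ by linarith)).1 (by linarith [hc.2])
        exact mul_nonneg bump.nonneg (hfη t (by rw [abs_lt]; constructor <;> linarith)).1.le
    · exact mul_pos (bump.pos_of_mem_ball (Metric.mem_ball_self hκ)) hf0
  · intro r t ht hr
    refine hKz' r t (lt_abs.2 (Or.inl ?_))
    have : τ ε ≤ τ t := hmono.monotoneOn hε (hε.trans_le ht) ht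
    linarith
  · intro r hr
    exact hKz' r t₁ (lt_abs.2 (Or.inl (by linarith)))
  · intro y
    by_cases hc : κ < |τ ε + ‖y‖ - τ t₀|
    · exact Or.inl (hKz' _ _ hc)
    · exact Or.inr (hinit y (by linarith [not_lt.1 hc]))

/-- The set `{0, 1, -1}` is symmetric, so the result for the lower components also applies to the
swapped spinor with mass `-m`. -/
theorem components_eq_zero {a₀ ℓ : ℝ} (ha₀ : 0 < a₀) (hℓ : ℓ ≠ 1) {m M : ℂ}
    (hM : I * m = M * (1 - ℓ)) (hM' : M = 0 ∨ M = 1 ∨ M = -1) {ε : ℝ} (hε : 0 < ε)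
    {ψ : Fin 4 → Space × ℝ → ℂ} (hψ : IsComponentSolution a₀ ℓ m ε ψ) {t₀ : ℝ} (ht₀ : ε < t₀)
    {κ₀ : ℝ} (hκ₀ : 0 < κ₀)
    (hinit : ∀ y : Space,
      |conformalTime a₀ ℓ ε + ‖y‖ - conformalTime a₀ ℓ t₀| ≤ κ₀ → ∀ i, ψ i (y, ε) = 0)
    (i : Fin 4) : ψ i (0, t₀) = 0 := by
  have hlow := lower_combination_eq_zero ha₀ hℓ hM hM' hε hψ ht₀ hκ₀ hinit
  have hneg : -M = 0 ∨ -M = 1 ∨ -M = -1 := by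
    rcases hM' with h | h | h <;> simp [h]
  have hup := lower_combination_eq_zero ha₀ hℓ (M := -M) (by linear_combination -hM) hneg hε
    hψ.swap ht₀ hκ₀ fun y hy i => hinit y hy _
  fin_cases i
  · simpa using hup 1 0
  · simpa using hup 0 1
  · simpa using hlow 1 0
  · simpa using hlow 0 1

end DiracFLRW

end

theorem theorem2p1 (a₀ ℓ : ℝ) (ha₀ : 0 < a₀) (hℓ : ℓ ≠ 1) (m : ℂ) (ε : ℝ) (hε : 0 < ε)
    (aPlus aMinus : ℂ) (bPlus bMinus : ℝ → ℂ)
    (hPlus : ∀ t, ε < t → ∀ r ∈ Set.Icc (0 : ℝ) (DiracFLRW.phi ℓ t - DiracFLRW.phi ℓ ε),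
      DiracFLRW.K₁ ℓ m ε r t = (r : ℂ) ^ 2 * aPlus + bPlus t)
    (hMinus : ∀ t, ε < t → ∀ r ∈ Set.Icc (0 : ℝ) (DiracFLRW.phi ℓ t - DiracFLRW.phi ℓ ε),
      DiracFLRW.K₁ ℓ (-m) ε r t = (r : ℂ) ^ 2 * aMinus + bMinus t) :
    DiracFLRW.ObeysHuygens a₀ ℓ m ε := by
  obtain ⟨M, hM, hM'⟩ := DiracFLRW.parameter_cases hℓ hε hPlus hMinus
  intro Φ _ hΦ Ψ hΨ x t ht hx
  have hcomp : IsCompact ((fun y => ‖x - y‖) '' tsupport Φ) :=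
    IsCompact.image hΦ (by fun_prop)
  set R := DiracFLRW.conformalTime a₀ ℓ t - DiracFLRW.conformalTime a₀ ℓ ε with hR
  have hRmem : R ∉ (fun y => ‖x - y‖) '' tsupport Φ := by
    rintro ⟨y, hy, h⟩
    refine hx y hy (DiracFLRW.nullReachable_of_dist ha₀ hℓ hε ht ?_)
    rw [sub_div]; exact h
  -- Compactness of the support upgrades a sphere that misses it to a shell of positive thickness
  -- that misses it.
  obtain ⟨κ, hκ, hball⟩ := Metric.isOpen_iff.1 hcomp.isClosed.isOpen_compl R hRmem
  have h0 : ∀ i, Ψ (x + 0) t i = 0 := DiracFLRW.components_eq_zero ha₀ hℓ hM hM' hε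
    (hΨ.components ha₀ hε x) ht (half_pos hκ) fun y hy i => by
      have hmem : ‖y‖ ∈ Metric.ball R κ := by
        rw [Metric.mem_ball, Real.dist_eq, hR]
        refine lt_of_le_of_lt (le_of_eq ?_) (hy.trans_lt (half_lt_self hκ))
        congr 1; ring
      have hy' : x + y ∉ tsupport Φ := fun h => hball hmem ⟨x + y, h, by simp⟩
      change Ψ (x + y) ε i = 0
      rw [hΨ.initial, image_eq_zero_of_notMem_tsupport hy', Pi.zero_apply]
  ext i
  simpa using h0 i
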